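/- Let $n\ge 1$, $\boldsymbol t=(t_1,\dots,t_n)$. For a field $k$, a power series $f\in k[[\boldsymbol t]]$ is algebraic over $k(\boldsymbol t)$ if $A(\boldsymbol t,f)=0$ for some nonzero polynomial $A(\boldsymbol t,y)\in k[\boldsymbol t,y]$. In that case the degree of $f$ is the minimal degree in $y$ of such polynomials $A$, the total height of $f$ is the minimal total degree in $\boldsymbol t$ of such polynomials $A$, and the partial height of $f$ is $(h_1,\dots,h_n)$, where $h_i$ is the minimal degree in $t_i$ of such polynomials $A$. Let $f=\sum_{\boldsymbol i\in\mathbb N^n}a(\boldsymbol i)\boldsymbol t^{\boldsymbol i}\in\mathbb Z[[\boldsymbol t]]$ be algebraic over $\mathbb Q(\boldsymbol t)$, with degree $d$, total height $h$ and partial height $(h_1,\dots,h_n)$ (as an element of $\mathbb Q[[\boldsymbol t]]$). Set $$N=(d+1)\cdot\min\left\{\prod_{i=1}^n(h_i+1)-\prod_{i=1}^n h_i,\ \binom{n+h}{n}-\binom{h}{n}\right\}.$$ Then, for every prime number $p$, the reduction modulo $p$ of the diagonal of $f$, $$\Delta(f)_{|p}=\sum_{i\ge 0}\bigl(a(i,\dots,i)\bmod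 p\bigr)\,t^i\in\mathbb F_p[[t]],$$ is algebraic over $\mathbb F_p(t)$ of degree at most $p^N-1$. -/

import Mathlib

noncomputable section

/-- The value `A(t, f)` in `k[[t]]` of a polynomial `A` in `k[t, y]`, viewed as a polynomial in `y`
with coefficients in `k[t]`, at `y = f`. Here `t` is a family of variables indexed by `σ`. -/
def evalAtSeries {σ k : Type*} [Field k] (f : MvPowerSeries σ k)
    (A : Polynomial (MvPolynomial σ k)) : MvPowerSeries σ k :=
  A.eval₂ MvPolynomial.coeToMvPowerSeries.ringHom f

/-- The degree of `A` in `t_i`. -/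
def degT {σ k : Type*} [Field k] (i : σ) (A : Polynomial (MvPolynomial σ k)) : ℕ :=
  A.support.sup fun j => (A.coeff j).degreeOf i

/-- The total degree of `A` in the variables `t` (the variable `y` does not count). -/
def totalDegT {σ k : Type*} [Field k] (A : Polynomial (MvPolynomial σ k)) : ℕ :=
  A.support.sup fun j => (A.coeff j).totalDegree

/-- `f` is algebraic over `k(t)` of degree `d`: the number `d` is the minimal degree in `y` of a
nonzero `A` in `k[t, y]` with `A(t, f) = 0`. In particular such an `A` exists.
The univariate case is `σ = Unit`, as `PowerSeries k` is `MvPowerSeries Unit k`. -/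
def HasAlgDegree {σ k : Type*} [Field k] (f : MvPowerSeries σ k) (d : ℕ) : Prop :=
  IsLeast {m | ∃ A : Polynomial (MvPolynomial σ k),
    A ≠ 0 ∧ evalAtSeries f A = 0 ∧ A.natDegree = m} d

/-- `h` is the minimal total degree in `t` of a nonzero `A` in `k[t, y]` with `A(t, f) = 0`. -/
def HasTotalHeight {σ k : Type*} [Field k] (f : MvPowerSeries σ k) (h : ℕ) : Prop :=
  IsLeast {m | ∃ A : Polynomial (MvPolynomial σ k),
    A ≠ 0 ∧ evalAtSeries f A = 0 ∧ totalDegT A = m} h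

/-- For every `i`, the number `h i` is the minimal degree in `t_i` of a nonzero `A` in `k[t, y]`
with `A(t, f) = 0`. -/
def HasPartialHeight {σ k : Type*} [Field k] (f : MvPowerSeries σ k) (h : σ → ℕ) : Prop :=
  ∀ i, IsLeast {m | ∃ A : Polynomial (MvPolynomial σ k),
    A ≠ 0 ∧ evalAtSeries f A = 0 ∧ degT i A = m} (h i)

/-- The diagonal: the coefficient of `t ^ i` in `diagonal f` is the coefficient of
`t_1 ^ i ⋯ t_n ^ i` in `f`. -/
def diagonal {n : ℕ} {R : Type*} [CommRing R] (f : MvPowerSeries (Fin n) R) : PowerSeries R :=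
  PowerSeries.mk fun i => MvPowerSeries.coeff (Finsupp.equivFunOnFinite.symm fun _ => i) f

/-- The exponent in the bound. Both subtractions are of a smaller number from a larger one. -/
def boundN {n : ℕ} (d h : ℕ) (hs : Fin n → ℕ) : ℕ :=
  (d + 1) * min ((∏ i, (hs i + 1)) - ∏ i, hs i) ((n + h).choose n - h.choose n)

end

/-! The argument is a Cartier-operator (Christol type) argument with careful counting of dimensions.

Polynomials vanishing at `f` over `ℚ` are the multiples of a single one (Gauss's lemma), which
therefore attains degree, total height and all partial heights at once. Scaled to be primitive at
`p`, it reduces to a nonzero relation mod `p` with the same bounds. Power series embed into the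
field of Hahn series over lexicographic `ℤ^n`, where division is possible, and `exists_simple_root`
replaces the reduced relation by some `A` within the same bounds with `A'(f) ≠ 0`.

Let `V` be the set of `P(f) / A'(f)` with `deg P < d` and exponents of `P` in the box or simplex of
`A`. Sections `Λ_ρ` with residues in `[0, p)` preserve `V`: by `cartier_eval_mul_derivative_pow`,
`Λ_ρ` sends `P` to a section of `P A^(p-1)`, and taking a section divides degrees and exponents by
`p`. Also `f ∈ V`. Diagonals commute with sections, and the diagonal of `V` lies in the
`𝔽_p[t]`-span of the diagonals of `t^e f^j / A'(f)` with `j < d` and some `e_i = 0`, because a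
factor `t_1 ⋯ t_n` becomes `t`.

Let `M` be the number of these generators. Since `x = ∑ t^r (Λ_r x)^p`, each lies in the span of the
`p`-th powers of all. Hence `x, x^p, …, x^(p^M)` with `x = Δ(f)` all lie in a span of `M` elements
and are dependent; cancelling one factor `x` leaves degree at most `p^M - 1`. -/

/-! ### Supports of powers and restriction of exponents for Hahn series -/

open Pointwise in
theorem HahnSeries.support_pow_subset_nsmul {Γ R : Type*} [AddCommGroup Γ] [LinearOrder Γ]
    [IsOrderedAddMonoid Γ] [CommRing R] (z : HahnSeries Γ R) (m : ℕ) :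
    (z ^ m).support ⊆ m • z.support := by
  induction m with
  | zero =>
    rw [pow_zero, zero_nsmul]
    intro g hg
    by_contra h
    apply hg
    rw [HahnSeries.coeff_one, if_neg (by simpa using h)]
  | succ m ih =>
    rw [pow_succ, succ_nsmul]
    exact HahnSeries.support_mul_subset.trans (Set.add_subset_add_right ih)

open Pointwise in
theorem Set.IsPWO.nsmul_set {Γ : Type*} [AddCommGroup Γ] [LinearOrder Γ]
    [IsOrderedAddMonoid Γ] {s : Set Γ} (hs : s.IsPWO) (m : ℕ) : (m • s).IsPWO := by
  induction m with
  | zero => rw [zero_nsmul]; exact Set.isPWO_singleton _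
  | succ m ih => rw [succ_nsmul]; exact ih.add hs

/-- Restriction of the exponents of a Hahn series along an order embedding. -/
def HahnSeries.comapDomain {Γ Γ' R : Type*} [PartialOrder Γ] [PartialOrder Γ'] [CommRing R]
    (φ : Γ' ↪o Γ) : HahnSeries Γ R →ₗ[R] HahnSeries Γ' R where
  toFun x :=
    { coeff := fun g => x.coeff (φ g)
      isPWO_support' := by
        intro u
        obtain ⟨a, b, hab, h⟩ := x.isPWO_support' (fun m => ⟨φ (u m), (u m).2⟩)
        exact ⟨a, b, hab, φ.le_iff_le.1 h⟩ }
  map_add' x y := by ext; simp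
  map_smul' c x := by ext; simp

/-! ### Section operators on Hahn series over `𝔽_p` -/

section Sections

variable {Γ : Type*} [AddCommGroup Γ] [LinearOrder Γ] [IsOrderedAddMonoid Γ]
variable {p : ℕ} [hp : Fact p.Prime]

/-- The embedding `g ↦ p g + ρ`. -/
def nsmulAddEmbedding (p : ℕ) [hp : Fact p.Prime] (ρ : Γ) : Γ ↪o Γ :=
  OrderEmbedding.ofStrictMono (fun g => p • g + ρ) fun _ _ h =>
    add_lt_add_left (nsmul_lt_nsmul_right hp.out.ne_zero h) ρ

/-- The section (Cartier) operator that keeps the exponents congruent to `ρ` modulo `p`. -/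
def cartier (p : ℕ) [Fact p.Prime] (ρ : Γ) :
    HahnSeries Γ (ZMod p) →ₗ[ZMod p] HahnSeries Γ (ZMod p) :=
  HahnSeries.comapDomain (nsmulAddEmbedding p ρ)

@[simp]
theorem coeff_cartier (ρ : Γ) (x : HahnSeries Γ (ZMod p)) (g : Γ) :
    (cartier p ρ x).coeff g = x.coeff (p • g + ρ) := rfl

theorem cartier_mul_single_pow (ρ c : Γ) (a : HahnSeries Γ (ZMod p)) (r : ZMod p) :
    cartier p ρ (a * (HahnSeries.single c r) ^ p) = cartier p ρ a * HahnSeries.single c r := by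
  ext g
  rw [HahnSeries.single_pow, ZMod.pow_card, coeff_cartier, HahnSeries.coeff_mul_single,
    HahnSeries.coeff_mul_single, coeff_cartier]
  congr 2
  rw [nsmul_sub]; abel

instance HahnSeries.charP_zmod : CharP (HahnSeries Γ (ZMod p)) p :=
  charP_of_injective_ringHom (HahnSeries.C_injective (Γ := Γ) (R := ZMod p)) p

-- Frobenius is additive on finite sums only, so for each coefficient `u` is replaced by a finite
-- part `y` that alone can contribute.
open Pointwise in
theorem cartier_mul_pow (ρ : Γ) (a u : HahnSeries Γ (ZMod p)) :
    cartier p ρ (a * u ^ p) = cartier p ρ a * u := by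
  classical
  ext g
  have hs := u.isPWO_support
  have ht : ((p - 1) • u.support + a.support).IsPWO := (hs.nsmul_set _).add a.isPWO_support
  -- Exponents of `u` that can take part in the coefficient at `p • g + ρ`; they are finitely many
  -- because both supports are well ordered.
  set T := (Finset.antidiagonal hs ht (p • g + ρ)).image Prod.fst with hT
  set y : HahnSeries Γ (ZMod p) := ∑ c ∈ T, HahnSeries.single c (u.coeff c) with hy
  set z := u - y with hz
  have hyc : ∀ c, y.coeff c = if c ∈ T then u.coeff c else 0 := by
    intro c
    rw [hy, HahnSeries.coeff_sum]
    split_ifs with h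
    · rw [Finset.sum_eq_single_of_mem c h fun b _ hb =>
        HahnSeries.coeff_single_of_ne hb.symm, HahnSeries.coeff_single_same]
    · exact Finset.sum_eq_zero fun b hb =>
        HahnSeries.coeff_single_of_ne fun e => h (e ▸ hb)
  have hzc : ∀ c, c ∈ z.support → c ∈ u.support ∧ c ∉ T := by
    intro c hc
    rw [HahnSeries.mem_support, hz, HahnSeries.coeff_sub, hyc] at hc
    by_cases h : c ∈ T
    · simp [h] at hc
    · simpa [h] using hc
  have key : ∀ c ∈ z.support, ∀ b ∈ (p - 1) • u.support + a.support, c + b ≠ p • g + ρ := by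
    intro c hc b hb h
    apply (hzc c hc).2
    rw [hT, Finset.mem_image]
    exact ⟨(c, b), Finset.mem_antidiagonal.2 ⟨(hzc c hc).1, hb, h⟩, rfl⟩
  have hzu : z.support ⊆ u.support := fun c hc => (hzc c hc).1
  have hp1 : (p - 1) + 1 = p := Nat.succ_pred_eq_of_pos hp.out.pos
  have hset : ∀ s : Set Γ, p • s = (p - 1) • s + s := fun s => by rw [← succ_nsmul, hp1]
  have h1 : (a * z ^ p).coeff (p • g + ρ) = 0 := by
    by_contra h
    obtain ⟨α, hα, β, hβ, hαβ⟩ := HahnSeries.support_mul_subset h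
    have hβ' := HahnSeries.support_pow_subset_nsmul z p hβ
    rw [hset] at hβ'
    obtain ⟨b, hb, c, hc, hbc⟩ := hβ'
    refine key c hc (b + α) ⟨b, Set.nsmul_subset_nsmul_left hzu hb, α, hα, rfl⟩ ?_
    rw [← hαβ, ← hbc]
    simp only; abel
  -- If `α + β = g`, then `p • g + ρ = β + ((p - 1) • β + (p • α + ρ))`, which `key` excludes.
  have h2 : (cartier p ρ a * z).coeff g = 0 := by
    by_contra h
    obtain ⟨α, hα, β, hβ, hαβ⟩ := HahnSeries.support_mul_subset h
    refine key β hβ ((p - 1) • β + (p • α + ρ)) ⟨_, ?_, _, hα, rfl⟩ ?_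
    · exact Set.nsmul_mem_nsmul (hzu hβ)
    · rw [← hαβ]
      have : β + (p - 1) • β = p • β := by
        rw [← succ_nsmul', hp1]
      rw [← add_assoc, this, nsmul_add]; abel
  have h3 : cartier p ρ (a * y ^ p) = cartier p ρ a * y := by
    rw [hy, sum_pow_char p, Finset.mul_sum, Finset.mul_sum, map_sum]
    exact Finset.sum_congr rfl fun c _ => cartier_mul_single_pow ρ c a _
  have hu : u = y + z := by rw [hz]; ring
  rw [hu, add_pow_char, mul_add, mul_add, map_add, h3, HahnSeries.coeff_add, HahnSeries.coeff_add,
    h2, coeff_cartier (ρ := ρ) (x := a * z ^ p), h1]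

/-- Write `a / u = a u^(p-1) / u^p` and pull out the `p`-th power. -/
theorem cartier_div (ρ : Γ) (a u : HahnSeries Γ (ZMod p)) (hu : u ≠ 0) :
    cartier p ρ (a / u) = cartier p ρ (a * u ^ (p - 1)) / u := by
  rw [eq_div_iff hu, ← cartier_mul_pow]
  congr 1
  rw [← mul_pow_sub_one hp.out.ne_zero, ← mul_assoc, div_mul_cancel₀ _ hu]

end Sections

/-! ### Section operators at a root of a polynomial -/

section PolyCartier

open Polynomial

variable {Γ : Type*} [AddCommGroup Γ] [LinearOrder Γ] [IsOrderedAddMonoid Γ]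
variable {p : ℕ} [hp : Fact p.Prime]

/-- The section operator on polynomials in `y` with Hahn series coefficients that keeps the
exponents of `y` congruent to `s` and those of the coefficients congruent to `ρ`. -/
noncomputable def polyCartier (p : ℕ) [Fact p.Prime] (ρ : Γ) (s : ℕ) (G : (HahnSeries Γ (ZMod p))[X]) :
    (HahnSeries Γ (ZMod p))[X] :=
  ∑ q ∈ Finset.range (G.natDegree + 1), monomial q (cartier p ρ (G.coeff (p * q + s)))

@[simp]
theorem coeff_polyCartier (ρ : Γ) (s q : ℕ) (G : (HahnSeries Γ (ZMod p))[X]) :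
    (polyCartier p ρ s G).coeff q = cartier p ρ (G.coeff (p * q + s)) := by
  rw [polyCartier, finsetSum_coeff]
  simp only [coeff_monomial, Finset.sum_ite_eq', Finset.mem_range]
  split_ifs with h
  · rfl
  · have h1 : q ≤ p * q := Nat.le_mul_of_pos_left _ hp.out.pos
    rw [coeff_eq_zero_of_natDegree_lt (by omega), map_zero]

theorem polyCartier_add (ρ : Γ) (s : ℕ) (G G' : (HahnSeries Γ (ZMod p))[X]) :
    polyCartier p ρ s (G + G') = polyCartier p ρ s G + polyCartier p ρ s G' := by
  ext1 q
  simp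

theorem polyCartier_sub (ρ : Γ) (s : ℕ) (G G' : (HahnSeries Γ (ZMod p))[X]) :
    polyCartier p ρ s (G - G') = polyCartier p ρ s G - polyCartier p ρ s G' := by
  ext1 q
  simp

theorem polyCartier_mul_C_pow (ρ : Γ) (s : ℕ) (G : (HahnSeries Γ (ZMod p))[X])
    (u : HahnSeries Γ (ZMod p)) :
    polyCartier p ρ s (G * C (u ^ p)) = polyCartier p ρ s G * C u := by
  ext1 q
  rw [coeff_polyCartier, coeff_mul_C, coeff_mul_C, cartier_mul_pow, coeff_polyCartier]

theorem polyCartier_mul_X_pow (ρ : Γ) {s : ℕ} (hs : s < p) (G : (HahnSeries Γ (ZMod p))[X]) :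
    polyCartier p ρ s (G * X ^ p) = polyCartier p ρ s G * X := by
  ext1 q
  rw [coeff_polyCartier]
  cases q with
  | zero => rw [coeff_mul_X_zero, coeff_mul_X_pow', if_neg (by omega), map_zero]
  | succ q =>
    rw [coeff_mul_X, coeff_polyCartier, show p * (q + 1) + s = p * q + s + p by ring,
      coeff_mul_X_pow]

theorem polyCartier_mul_X_sub_C_pow (ρ : Γ) {s : ℕ} (hs : s < p)
    (G : (HahnSeries Γ (ZMod p))[X]) (f : HahnSeries Γ (ZMod p)) :
    polyCartier p ρ s (G * (X - C f) ^ p) = polyCartier p ρ s G * (X - C f) := by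
  rw [sub_pow_char, ← C_pow, mul_sub, polyCartier_sub, polyCartier_mul_X_pow ρ hs,
    polyCartier_mul_C_pow, mul_sub]

/-- The power is monic of degree `p - 1`, so its leading term is the only one with exponent
congruent to `p - 1`. -/
theorem polyCartier_C_mul_X_sub_C_pow (ρ : Γ) (m f : HahnSeries Γ (ZMod p)) :
    polyCartier p ρ (p - 1) (C m * (X - C f) ^ (p - 1)) = C (cartier p ρ m) := by
  have hmon : ((X - C f) ^ (p - 1)).Monic := (monic_X_sub_C f).pow _
  have hdeg : ((X - C f) ^ (p - 1)).natDegree = p - 1 := by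
    rw [(monic_X_sub_C f).natDegree_pow, natDegree_X_sub_C, mul_one]
  ext1 q
  rw [coeff_polyCartier, coeff_C_mul]
  cases q with
  | zero =>
    have h1 := hmon.coeff_natDegree
    rw [hdeg] at h1
    rw [mul_zero, zero_add, h1, mul_one, coeff_C_zero]
  | succ q =>
    have h1 : 0 < p * (q + 1) := Nat.mul_pos hp.out.pos q.succ_pos
    rw [coeff_eq_zero_of_natDegree_lt (by omega), mul_zero, map_zero, coeff_C_succ]

/-- At a root `f` of `A`, the section operators act on `P(f) / A'(f)` through polynomials. -/
theorem cartier_eval_mul_derivative_pow (ρ : Γ) (A P : (HahnSeries Γ (ZMod p))[X])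
    (f : HahnSeries Γ (ZMod p)) (hA : A.eval f = 0) :
    cartier p ρ (P.eval f * (derivative A).eval f ^ (p - 1)) =
      (polyCartier p ρ (p - 1) (P * A ^ (p - 1))).eval f := by
  obtain ⟨B, rfl⟩ := dvd_iff_isRoot.2 hA
  have hM : (P * B ^ (p - 1) - C ((P * B ^ (p - 1)).eval f)).IsRoot f := by simp
  obtain ⟨M, hM⟩ := dvd_iff_isRoot.2 hM
  -- With `A = (X - f) B`, one has `A'(f) = B(f)`. The section of the first summand is the wanted
  -- constant; that of the second is a multiple of `X - f` and vanishes at `f`.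
  have hM' : P * ((X - C f) * B) ^ (p - 1) =
      C ((P * B ^ (p - 1)).eval f) * (X - C f) ^ (p - 1) + M * (X - C f) ^ p := by
    rw [← mul_pow_sub_one hp.out.ne_zero (X - C f), mul_pow]
    linear_combination (X - C f) ^ (p - 1) * hM
  rw [hM', polyCartier_add, polyCartier_C_mul_X_sub_C_pow,
    polyCartier_mul_X_sub_C_pow ρ (by have := hp.out.pos; omega)]
  simp

/-- All the coefficients of `G` have exponents in `S`. -/
def CoeffsIn (S : Set Γ) (G : (HahnSeries Γ (ZMod p))[X]) : Prop :=
  ∀ j, (G.coeff j).support ⊆ S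

theorem CoeffsIn.coeff_eq_zero {S : Set Γ} {G : (HahnSeries Γ (ZMod p))[X]}
    (h : CoeffsIn S G) (j : ℕ) {g : Γ} (hg : g ∉ S) : (G.coeff j).coeff g = 0 := by
  by_contra h1
  exact hg (h j h1)

theorem coeffsIn_of_coeff_eq_zero {S : Set Γ} {G : (HahnSeries Γ (ZMod p))[X]}
    (h : ∀ j, ∀ g ∉ S, (G.coeff j).coeff g = 0) : CoeffsIn S G :=
  fun j g hg => by_contra fun h1 => hg (h j g h1)

theorem CoeffsIn.derivative {S : Set Γ} {G : (HahnSeries Γ (ZMod p))[X]} (h : CoeffsIn S G) :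
    CoeffsIn S (Polynomial.derivative G) := by
  refine coeffsIn_of_coeff_eq_zero fun j g hg => ?_
  rw [coeff_derivative, ← Nat.cast_succ, mul_comm, ← nsmul_eq_mul, HahnSeries.coeff_smul,
    h.coeff_eq_zero _ hg, smul_zero]

open Pointwise in
theorem CoeffsIn.mul {S T : Set Γ} {G G' : (HahnSeries Γ (ZMod p))[X]} (h : CoeffsIn S G)
    (h' : CoeffsIn T G') : CoeffsIn (S + T) (G * G') := by
  refine coeffsIn_of_coeff_eq_zero fun j g hg => ?_
  rw [Polynomial.coeff_mul, HahnSeries.coeff_sum]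
  refine Finset.sum_eq_zero fun x _ => ?_
  by_contra h1
  exact hg (Set.add_subset_add (h _) (h' _) (HahnSeries.support_mul_subset h1))

open Pointwise in
theorem coeffsIn_one : CoeffsIn (0 : Set Γ) (1 : (HahnSeries Γ (ZMod p))[X]) := by
  refine coeffsIn_of_coeff_eq_zero fun j g hg => ?_
  rw [Polynomial.coeff_one]
  split_ifs
  · rw [HahnSeries.coeff_one, if_neg (by simpa using hg)]
  · rfl

open Pointwise in
theorem CoeffsIn.pow {S : Set Γ} {G : (HahnSeries Γ (ZMod p))[X]} (h : CoeffsIn S G) (m : ℕ) :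
    CoeffsIn (m • S) (G ^ m) := by
  induction m with
  | zero => rw [zero_nsmul, pow_zero]; exact coeffsIn_one
  | succ m ih => rw [succ_nsmul, pow_succ]; exact ih.mul h

theorem CoeffsIn.polyCartier {S T : Set Γ} {G : (HahnSeries Γ (ZMod p))[X]} (h : CoeffsIn T G)
    {ρ : Γ} (hST : ∀ g, p • g + ρ ∈ T → g ∈ S) (s : ℕ) : CoeffsIn S (polyCartier p ρ s G) := by
  refine coeffsIn_of_coeff_eq_zero fun j g hg => ?_
  rw [coeff_polyCartier, coeff_cartier, h.coeff_eq_zero _ fun h1 => hg (hST g h1)]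

-- The product has exponents in `p • S`, and the section brings them back to `S`: the bound does not
-- grow.
open Pointwise in
theorem CoeffsIn.polyCartier_mul_pow {S : Set Γ} {A P : (HahnSeries Γ (ZMod p))[X]}
    (hA : CoeffsIn S A) (hP : CoeffsIn S P) {ρ : Γ} (hS : ∀ g, p • g + ρ ∈ p • S → g ∈ S) (s : ℕ) :
    CoeffsIn S (_root_.polyCartier p ρ s (P * A ^ (p - 1))) := by
  refine CoeffsIn.polyCartier (T := p • S) ?_ hS s
  have h := hP.mul (hA.pow (p - 1))
  rwa [← succ_nsmul', Nat.sub_add_cancel hp.out.pos] at h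

/-- The product has degree below `p d`, while the coefficient of index `q ≥ d` is read off at `p q +
p - 1 ≥ p d`. -/
theorem natDegree_polyCartier_mul_pow_lt {d : ℕ} {A P : (HahnSeries Γ (ZMod p))[X]}
    (hA : A.natDegree ≤ d) (hP : P.natDegree < d) (ρ : Γ) :
    (polyCartier p ρ (p - 1) (P * A ^ (p - 1))).natDegree < d := by
  have h1 : (P * A ^ (p - 1)).natDegree ≤ P.natDegree + (p - 1) * d :=
    natDegree_mul_le.trans (Nat.add_le_add_left
      (natDegree_pow_le.trans (Nat.mul_le_mul_left _ hA)) _)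
  refine Nat.lt_of_le_of_lt (m := d - 1) (natDegree_le_iff_coeff_eq_zero.2 fun q hq => ?_) (by omega)
  rw [coeff_polyCartier, coeff_eq_zero_of_natDegree_lt, map_zero]
  refine lt_of_le_of_lt h1 ?_
  obtain ⟨p', rfl⟩ : ∃ p', p = p' + 1 := ⟨p - 1, (Nat.sub_add_cancel hp.out.pos).symm⟩
  have : (p' + 1) * d ≤ (p' + 1) * q := Nat.mul_le_mul_left _ (by omega)
  simp only [Nat.add_sub_cancel]
  nlinarith

/-- A root of a nonzero polynomial with bounded coefficients is a simple root of a polynomial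
with the same bounds. -/
theorem exists_simple_root {S R : Set Γ} (hR : ∀ g, ∃ ρ ∈ R, ∃ g', g = p • g' + ρ)
    (hS : ∀ ρ ∈ R, ∀ g, p • g + ρ ∈ S → g ∈ S) (f : HahnSeries Γ (ZMod p))
    (G : (HahnSeries Γ (ZMod p))[X]) (hG0 : G ≠ 0) (hGS : CoeffsIn S G) (hGf : G.eval f = 0) :
    ∃ A : (HahnSeries Γ (ZMod p))[X], CoeffsIn S A ∧ A.eval f = 0 ∧
      (derivative A).eval f ≠ 0 ∧ A.natDegree ≤ G.natDegree := by
  induction hm : G.natDegree using Nat.strong_induction_on generalizing G with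
  | _ m ih =>
  subst hm
  have hdeg : G.natDegree ≠ 0 := by
    intro h
    rw [eq_C_of_natDegree_eq_zero h, eval_C] at hGf
    exact hG0 (by rw [eq_C_of_natDegree_eq_zero h, hGf, C_0])
  by_cases h1 : (derivative G).eval f = 0
  swap
  · exact ⟨G, hGS, hGf, h1, le_rfl⟩
  by_cases h2 : derivative G = 0
  swap
  · obtain ⟨A, hA⟩ := ih _ (natDegree_derivative_lt hdeg) _ h2 hGS.derivative h1 rfl
    exact ⟨A, hA.1, hA.2.1, hA.2.2.1, hA.2.2.2.trans (natDegree_derivative_lt hdeg).le⟩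
  -- The derivative vanishes identically, so `G` is a polynomial in `y^p`; a nonzero section of it
  -- has smaller degree and still kills `f`.
  have hpow : ∀ j, ¬ p ∣ j → G.coeff j = 0 := by
    intro j hj
    cases j with
    | zero => exact absurd (dvd_zero p) hj
    | succ j =>
      have h3 : (derivative G).coeff j = 0 := by rw [h2, coeff_zero]
      rw [coeff_derivative, ← Nat.cast_succ] at h3
      refine (mul_eq_zero.1 h3).resolve_right fun h4 => hj ?_
      exact (CharP.cast_eq_zero_iff (HahnSeries Γ (ZMod p)) p _).1 h4
  obtain ⟨j, hj⟩ : ∃ j, G.coeff (p * j) ≠ 0 := by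
    by_contra! h
    refine hG0 (Polynomial.ext fun j => ?_)
    by_cases hj : p ∣ j
    · obtain ⟨i, rfl⟩ := hj
      rw [h, coeff_zero]
    · rw [hpow j hj, coeff_zero]
  obtain ⟨g, hg⟩ : ∃ g, (G.coeff (p * j)).coeff g ≠ 0 := by
    by_contra! h
    exact hj (HahnSeries.ext (funext h))
  obtain ⟨ρ, hρ, g', rfl⟩ := hR g
  set G' := polyCartier p ρ 0 G with hG'
  have hG'0 : G' ≠ 0 := by
    intro h
    apply hg
    rw [← coeff_cartier, ← add_zero (p * j), ← coeff_polyCartier, ← hG', h, coeff_zero,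
      HahnSeries.coeff_zero]
  have hlt : G'.natDegree < G.natDegree := by
    refine Nat.lt_of_le_of_lt (m := G.natDegree - 1) (natDegree_le_iff_coeff_eq_zero.2
      fun q hq => ?_) (by omega)
    rw [coeff_polyCartier, coeff_eq_zero_of_natDegree_lt, map_zero]
    have h3 : 2 * q ≤ p * q := Nat.mul_le_mul_right _ hp.out.two_le
    omega
  have heval : G'.eval f = 0 := by
    have h4 : cartier p ρ (G.eval f) = 0 := by rw [hGf, map_zero]
    have h5 : G.eval f = ∑ q ∈ Finset.range (G.natDegree + 1), G.coeff (p * q) * (f ^ q) ^ p := by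
      rw [eval_eq_sum_range' (n := p * (G.natDegree + 1))]
      swap
      · have := hp.out.two_le
        nlinarith
      have hinj : Set.InjOn (fun q => p * q) (Finset.range (G.natDegree + 1)) :=
        fun a _ b _ h => Nat.eq_of_mul_eq_mul_left hp.out.pos h
      refine (Finset.sum_of_injOn (fun q => p * q) hinj ?_ ?_ ?_).symm
      · intro q hq
        simp only [Finset.coe_range, Set.mem_Iio] at hq ⊢
        exact Nat.mul_lt_mul_of_pos_left hq hp.out.pos
      · intro i hi hi'
        rw [hpow i, zero_mul]
        rintro ⟨q, rfl⟩
        apply hi'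
        rw [Finset.mem_range] at hi
        exact ⟨q, by simpa using Nat.lt_of_mul_lt_mul_left hi, rfl⟩
      · intro q _
        rw [← pow_mul, mul_comm q p]
    rw [h5, map_sum] at h4
    rw [eval_eq_sum_range' (n := G.natDegree + 1) (by omega), ← h4]
    refine Finset.sum_congr rfl fun q _ => ?_
    rw [cartier_mul_pow, coeff_polyCartier, add_zero]
  obtain ⟨A, hA⟩ := ih _ hlt G' hG'0 (hGS.polyCartier (hS ρ hρ) 0) heval rfl
  exact ⟨A, hA.1, hA.2.1, hA.2.2.1, hA.2.2.2.trans hlt.le⟩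

end PolyCartier

/-! ### Power series as Hahn series, and their diagonals -/

/-- Exponent vectors of Laurent monomials in `n` variables, ordered lexicographically. -/
abbrev LexInt (n : ℕ) : Type := Lex (Fin n → ℤ)

/-- The exponent vectors of monomials as exponent vectors of Laurent monomials. -/
def natExponent (n : ℕ) : (Fin n →₀ ℕ) →+ LexInt n where
  toFun e := toLex fun i => (e i : ℤ)
  map_zero' := congrArg toLex (funext fun _ => Nat.cast_zero)
  map_add' e e' := congrArg toLex (funext fun i => Nat.cast_add (e i) (e' i))

@[simp]
theorem natExponent_apply {n : ℕ} (e : Fin n →₀ ℕ) (i : Fin n) :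
    natExponent n e i = (e i : ℤ) := rfl

theorem natExponent_injective (n : ℕ) : Function.Injective (natExponent n) := fun e e' h => by
  ext i
  have h1 : (e i : ℤ) = (e' i : ℤ) := congrFun h i
  exact_mod_cast h1

theorem natExponent_monotone (n : ℕ) : Monotone (natExponent n) := fun e e' h =>
  Pi.toLex_monotone fun i => by exact_mod_cast h i

section ToHahn

variable {n : ℕ} {R : Type*} [CommRing R]

/-- The coefficients of a power series, as a function on the exponents of Laurent monomials. -/
noncomputable def laurentCoeff (f : MvPowerSeries (Fin n) R) : LexInt n → R :=
  Function.extend (natExponent n) (fun e => MvPowerSeries.coeff e f) 0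

theorem laurentCoeff_natExponent (f : MvPowerSeries (Fin n) R) (e : Fin n →₀ ℕ) :
    laurentCoeff f (natExponent n e) = MvPowerSeries.coeff e f :=
  (natExponent_injective n).extend_apply _ _ e

theorem laurentCoeff_of_notMem_range (f : MvPowerSeries (Fin n) R) {g : LexInt n}
    (hg : g ∉ Set.range (natExponent n)) : laurentCoeff f g = 0 :=
  Function.extend_apply' _ _ _ hg

theorem support_laurentCoeff_subset (f : MvPowerSeries (Fin n) R) :
    Function.support (laurentCoeff f) ⊆ Set.range (natExponent n) :=
  fun _ hg => by_contra fun h => hg (laurentCoeff_of_notMem_range f h)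

/-- Dickson's lemma, carried over by a monotone map. -/
theorem isPWO_range_natExponent (n : ℕ) : (Set.range (natExponent n)).IsPWO := by
  rw [← Set.image_univ]
  exact (Set.isPWO_of_wellQuasiOrderedLE Set.univ).image_of_monotone (natExponent_monotone n)

/-- A power series in several variables as a Hahn series. -/
noncomputable def toHahnFun (f : MvPowerSeries (Fin n) R) : HahnSeries (LexInt n) R where
  coeff := laurentCoeff f
  isPWO_support' := (isPWO_range_natExponent n).mono (support_laurentCoeff_subset f)

theorem laurentCoeff_one :
    laurentCoeff (1 : MvPowerSeries (Fin n) R) = fun g => if g = 0 then 1 else 0 := by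
  classical
  funext g
  by_cases hg : g ∈ Set.range (natExponent n)
  · obtain ⟨e, rfl⟩ := hg
    rw [laurentCoeff_natExponent, MvPowerSeries.coeff_one]
    simp only [map_eq_zero_iff _ (natExponent_injective n)]
  · rw [laurentCoeff_of_notMem_range _ hg, if_neg]
    rintro rfl
    exact hg ⟨0, map_zero _⟩

theorem toHahnFun_mul (f g : MvPowerSeries (Fin n) R) :
    toHahnFun (f * g) = toHahnFun f * toHahnFun g := by
  classical
  ext γ
  change laurentCoeff (f * g) γ = _
  by_cases hγ : γ ∈ Set.range (natExponent n)
  · obtain ⟨e, rfl⟩ := hγ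
    rw [laurentCoeff_natExponent, MvPowerSeries.coeff_mul, HahnSeries.coeff_mul]
    symm
    have hinj : Function.Injective (Prod.map (natExponent n) (natExponent n)) :=
      (natExponent_injective n).prodMap (natExponent_injective n)
    rw [Finset.sum_subset (s₂ := (Finset.HasAntidiagonal.antidiagonal e).map ⟨_, hinj⟩)]
    · rw [Finset.sum_map]
      refine Finset.sum_congr rfl fun x _ => ?_
      exact congrArg₂ _ (laurentCoeff_natExponent f _) (laurentCoeff_natExponent g _)
    · rintro ⟨a, b⟩ hab
      rw [Finset.mem_antidiagonal] at hab
      obtain ⟨ha, hb, h⟩ := hab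
      obtain ⟨a, rfl⟩ := support_laurentCoeff_subset f ha
      obtain ⟨b, rfl⟩ := support_laurentCoeff_subset g hb
      rw [Finset.mem_map]
      refine ⟨(a, b), ?_, rfl⟩
      rw [Finset.HasAntidiagonal.mem_antidiagonal]
      exact natExponent_injective n (by rw [map_add]; exact h)
    · rintro ⟨a, b⟩ hab hab'
      rw [Finset.mem_map] at hab
      obtain ⟨⟨a, b⟩, hab, h⟩ := hab
      cases h
      rw [Finset.HasAntidiagonal.mem_antidiagonal] at hab
      by_contra h0
      apply hab'
      rw [Finset.mem_antidiagonal]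
      refine ⟨left_ne_zero_of_mul h0, right_ne_zero_of_mul h0, ?_⟩
      change natExponent n a + natExponent n b = _
      rw [← map_add, hab]
  · rw [laurentCoeff_of_notMem_range _ hγ]
    by_contra h
    obtain ⟨a, ha, b, hb, hab⟩ := HahnSeries.support_mul_subset (Ne.symm h)
    obtain ⟨a, rfl⟩ := support_laurentCoeff_subset f ha
    obtain ⟨b, rfl⟩ := support_laurentCoeff_subset g hb
    exact hγ ⟨a + b, by rw [map_add]; exact hab⟩

/-- The embedding of power series in several variables into Hahn series. -/
noncomputable def toHahn : MvPowerSeries (Fin n) R →+* HahnSeries (LexInt n) R where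
  toFun := toHahnFun
  map_one' := by
    classical
    ext g
    rw [HahnSeries.coeff_one]
    refine (congrFun (laurentCoeff_one (n := n) (R := R)) g).trans ?_
    split_ifs <;> rfl
  map_mul' := toHahnFun_mul
  map_zero' := by
    ext g
    change laurentCoeff (0 : MvPowerSeries (Fin n) R) g = 0
    by_cases hg : g ∈ Set.range (natExponent n)
    · obtain ⟨e, rfl⟩ := hg
      rw [laurentCoeff_natExponent, map_zero]
    · rw [laurentCoeff_of_notMem_range _ hg]
  map_add' f f' := by
    ext g
    change laurentCoeff (f + f') g = laurentCoeff f g + laurentCoeff f' g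
    by_cases hg : g ∈ Set.range (natExponent n)
    · obtain ⟨e, rfl⟩ := hg
      simp only [laurentCoeff_natExponent, map_add]
    · simp only [laurentCoeff_of_notMem_range _ hg, add_zero]

@[simp]
theorem coeff_toHahn (f : MvPowerSeries (Fin n) R) (e : Fin n →₀ ℕ) :
    (toHahn f).coeff (natExponent n e) = MvPowerSeries.coeff e f :=
  laurentCoeff_natExponent f e

theorem coeff_toHahn_of_notMem_range (f : MvPowerSeries (Fin n) R) {g : LexInt n}
    (hg : g ∉ Set.range (natExponent n)) : (toHahn f).coeff g = 0 :=
  laurentCoeff_of_notMem_range f hg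

theorem toHahn_injective : Function.Injective (toHahn (n := n) (R := R)) :=
  fun f g h => MvPowerSeries.ext fun e => by rw [← coeff_toHahn, h, coeff_toHahn]

/-- The diagonal embedding of exponents. -/
noncomputable def diagExponent (n : ℕ) [NeZero n] : ℤ ↪o LexInt n :=
  OrderEmbedding.ofStrictMono (fun i => toLex fun _ => i) fun _ _ h =>
    Pi.toLex_strictMono (Pi.lt_def.2 ⟨fun _ => h.le, 0, h⟩)

theorem diagExponent_apply (n : ℕ) [NeZero n] (i : ℤ) (j : Fin n) : diagExponent n i j = i := rfl

theorem diagExponent_add (n : ℕ) [NeZero n] (i j : ℤ) :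
    diagExponent n (i + j) = diagExponent n i + diagExponent n j := rfl

theorem diagExponent_neg (n : ℕ) [NeZero n] (i : ℤ) :
    diagExponent n (-i) = -diagExponent n i := rfl

/-- The diagonal of a Hahn series in several variables. -/
noncomputable def hahnDiagonal (n : ℕ) [NeZero n] : HahnSeries (LexInt n) R →ₗ[R] HahnSeries ℤ R :=
  HahnSeries.comapDomain (diagExponent n)

theorem coeff_hahnDiagonal [NeZero n] (x : HahnSeries (LexInt n) R) (i : ℤ) :
    (hahnDiagonal n x).coeff i = x.coeff (diagExponent n i) := rfl

theorem hahnDiagonal_toHahn [NeZero n] (f : MvPowerSeries (Fin n) R) :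
    hahnDiagonal n (toHahn f) = HahnSeries.ofPowerSeries ℤ R (diagonal f) := by
  ext i
  rw [coeff_hahnDiagonal]
  by_cases hi : 0 ≤ i
  · obtain ⟨m, rfl⟩ := Int.eq_ofNat_of_zero_le hi
    rw [HahnSeries.ofPowerSeries_apply_coeff, diagonal, PowerSeries.coeff_mk, ← coeff_toHahn]
    rfl
  · rw [coeff_toHahn_of_notMem_range, HahnSeries.ofPowerSeries_apply,
      HahnSeries.embDomain_of_notMem_range]
    · rintro ⟨m, rfl⟩
      exact hi (Int.natCast_nonneg m)
    · rintro ⟨e, he⟩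
      have := congrFun he 0
      rw [diagExponent_apply, natExponent_apply] at this
      omega

theorem cartier_hahnDiagonal [NeZero n] {p : ℕ} [Fact p.Prime] (x : HahnSeries (LexInt n) (ZMod p))
    (r : ℤ) : cartier p r (hahnDiagonal n x) = hahnDiagonal n (cartier p (diagExponent n r) x) := by
  ext i
  simp only [coeff_cartier, coeff_hahnDiagonal]
  congr 1

/-- This is why exponents with a zero coordinate suffice as generators. -/
theorem hahnDiagonal_single_add_mul [NeZero n] (e : LexInt n) (m : ℤ) (a : R)
    (x : HahnSeries (LexInt n) R) :
    hahnDiagonal n (HahnSeries.single (e + diagExponent n m) a * x) =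
      HahnSeries.single m a * hahnDiagonal n (HahnSeries.single e 1 * x) := by
  ext i
  rw [coeff_hahnDiagonal, HahnSeries.coeff_single_mul, HahnSeries.coeff_single_mul,
    coeff_hahnDiagonal, HahnSeries.coeff_single_mul, one_mul]
  congr 2
  rw [sub_eq_add_neg i m, diagExponent_add, diagExponent_neg]
  abel

end ToHahn

/-! ### Frobenius relations and the degree of a power series in one variable -/

/-- A Laurent series over `𝔽_p` is recovered from its sections. -/
theorem sum_single_mul_cartier_pow {p : ℕ} [hp : Fact p.Prime] (x : HahnSeries ℤ (ZMod p)) :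
    ∑ r ∈ Finset.range p, HahnSeries.single (r : ℤ) 1 * cartier p (r : ℤ) x ^ p = x := by
  have hp0 : (0 : ℤ) < p := by exact_mod_cast hp.out.pos
  ext g
  -- The coefficient at `g` is seen by the section of residue `g % p`, which annihilates every term
  -- except `r = g % p`.
  have key : ∀ r ∈ Finset.range p, cartier p (g % p)
      (HahnSeries.single (r : ℤ) (1 : ZMod p) * cartier p (r : ℤ) x ^ p) =
        if r = (g % p).toNat then cartier p (g % p) x else 0 := by
    intro r hr
    rw [Finset.mem_range] at hr
    rw [cartier_mul_pow]
    have hg0 := Int.emod_nonneg g hp0.ne'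
    have hg1 := Int.emod_lt_of_pos g hp0
    split_ifs with h
    · have h' : g % p = r := by omega
      rw [h']
      convert one_mul _
      ext i
      rw [coeff_cartier, HahnSeries.coeff_one]
      by_cases hi : i = 0
      · subst hi
        simp
      · rw [if_neg hi, HahnSeries.coeff_single_of_ne]
        simpa [hp.out.ne_zero] using hi
    · convert zero_mul _
      ext i
      rw [coeff_cartier, HahnSeries.coeff_single_of_ne, HahnSeries.coeff_zero]
      intro h1
      apply h
      have h2 : ((r : ℤ)) % p = g % p := by
        rw [← h1, nsmul_eq_mul, Int.mul_add_emod_self_left,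
          Int.emod_emod_of_dvd _ dvd_rfl]
      rw [Int.emod_eq_of_lt (by omega) (by omega)] at h2
      omega
  have h1 : g = p • (g / p) + g % p := by
    rw [nsmul_eq_mul, Int.mul_ediv_add_emod]
  rw [h1, ← coeff_cartier, ← coeff_cartier, map_sum, Finset.sum_congr rfl key, Finset.sum_ite_eq',
    if_pos]
  rw [Finset.mem_range]
  have := Int.emod_lt_of_pos g hp0
  have := Int.emod_nonneg g hp0.ne'
  omega

/-- Frobenius is additive and raises the scalars to their `p`-th powers, which stay in `R`. -/
theorem pow_mem_span_range_pow {R L ι : Type*} [CommRing R] [CommRing L] [Algebra R L] {p : ℕ}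
    [Fact p.Prime] [CharP L p] (g : ι → L) {m : ℕ} {y : L}
    (hy : y ∈ Submodule.span R (Set.range fun i => g i ^ p ^ m)) :
    y ^ p ∈ Submodule.span R (Set.range fun i => g i ^ p ^ (m + 1)) := by
  induction hy using Submodule.span_induction with
  | mem y hy =>
    obtain ⟨i, rfl⟩ := hy
    refine Submodule.subset_span ⟨i, ?_⟩
    simp only [pow_succ, pow_mul]
  | zero => rw [zero_pow (Fact.out : p.Prime).ne_zero]; exact Submodule.zero_mem _
  | add x y _ _ hx hy => rw [add_pow_char]; exact Submodule.add_mem _ hx hy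
  | smul a x _ hx => rw [smul_pow]; exact Submodule.smul_mem _ _ hx

theorem pow_pow_mem_span_range_pow {R L ι : Type*} [CommRing R] [CommRing L] [Algebra R L] {p : ℕ}
    [Fact p.Prime] [CharP L p] (g : ι → L) {m : ℕ} {y : L}
    (hy : y ∈ Submodule.span R (Set.range fun i => g i ^ p ^ m)) (l : ℕ) :
    y ^ p ^ l ∈ Submodule.span R (Set.range fun i => g i ^ p ^ (m + l)) := by
  induction l with
  | zero => simpa using hy
  | succ l ih =>
    rw [pow_succ, pow_mul]
    exact pow_mem_span_range_pow g ih

/-- If finitely many elements lie in the span of their `p`-th powers, then the iterated `p`-th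
powers of an element of their span are linearly dependent. -/
theorem exists_frobenius_relation {R L ι : Type*} [CommRing R] [Nontrivial R] [CommRing L]
    [Algebra R L] {p : ℕ} [Fact p.Prime] [CharP L p] [Fintype ι] (g : ι → L)
    (hg : ∀ i, g i ∈ Submodule.span R (Set.range fun i => g i ^ p)) {x : L}
    (hx : x ∈ Submodule.span R (Set.range g)) :
    ∃ c : Fin (Fintype.card ι + 1) → R, c ≠ 0 ∧ ∑ j, c j • x ^ p ^ (j : ℕ) = 0 := by
  classical
  have hmono : Monotone fun m : ℕ => Submodule.span R (Set.range fun i => g i ^ p ^ m) := by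
    refine monotone_nat_of_le_succ fun m => ?_
    rw [Submodule.span_le]
    rintro _ ⟨i, rfl⟩
    have := pow_pow_mem_span_range_pow (R := R) g (m := 1) (y := g i) (by simpa using hg i) m
    rwa [add_comm] at this
  have hmem : ∀ j : Fin (Fintype.card ι + 1),
      x ^ p ^ (j : ℕ) ∈ Submodule.span R (Set.range fun i => g i ^ p ^ Fintype.card ι) := by
    intro j
    refine hmono (Nat.lt_succ_iff.1 j.2) ?_
    have := pow_pow_mem_span_range_pow (R := R) g (m := 0) (y := x) (by simpa using hx) j
    rwa [zero_add] at this
  -- One more vector than there are spanning elements.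
  have hdep : ¬ LinearIndependent R fun j : Fin (Fintype.card ι + 1) => x ^ p ^ (j : ℕ) := by
    intro hli
    have h1 := linearIndependent_le_span_aux' _ hli _ (by
      rintro _ ⟨j, rfl⟩
      exact hmem j)
    have h2 := Fintype.card_range_le (fun i => g i ^ p ^ Fintype.card ι)
    rw [Fintype.card_fin] at h1
    omega
  rw [Fintype.not_linearIndependent_iff] at hdep
  obtain ⟨c, hc, i, hi⟩ := hdep
  exact ⟨c, fun h => hi (congrFun h i), hc⟩

/-- The Laurent series expansion of a polynomial in one variable. -/
noncomputable def polyToLaurent (k : Type*) [Field k] : MvPolynomial Unit k →+* HahnSeries ℤ k :=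
  (HahnSeries.ofPowerSeries ℤ k).comp
    (MvPolynomial.coeToMvPowerSeries.ringHom : MvPolynomial Unit k →+* MvPowerSeries Unit k)

theorem polyToLaurent_C {k : Type*} [Field k] (a : k) :
    polyToLaurent k (MvPolynomial.C a) = HahnSeries.C a := by
  rw [polyToLaurent, RingHom.comp_apply, MvPolynomial.coeToMvPowerSeries.ringHom_apply,
    MvPolynomial.coe_C]
  exact HahnSeries.ofPowerSeries_C a

theorem polyToLaurent_X {k : Type*} [Field k] :
    polyToLaurent k (MvPolynomial.X ()) = HahnSeries.single 1 1 := by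
  rw [polyToLaurent, RingHom.comp_apply, MvPolynomial.coeToMvPowerSeries.ringHom_apply,
    MvPolynomial.coe_X]
  exact HahnSeries.ofPowerSeries_X

theorem polyToLaurent_C_mul_X_pow {k : Type*} [Field k] (a : k) (m : ℕ) :
    polyToLaurent k (MvPolynomial.C a * MvPolynomial.X () ^ m) = HahnSeries.single (m : ℤ) a := by
  rw [map_mul, map_pow, polyToLaurent_C, polyToLaurent_X, HahnSeries.single_pow, one_pow,
    HahnSeries.C_apply, HahnSeries.single_mul_single]
  simp

/-- A linear relation between iterated Frobenius powers of a power series bounds its degree. -/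
theorem exists_algebraic_relation_of_frobenius_relation {k : Type*} [Field k] {p : ℕ}
    [hp : Fact p.Prime] (g : PowerSeries k) {N : ℕ} (hN : 1 ≤ N)
    (c : Fin (N + 1) → MvPolynomial Unit k) (hc : c ≠ 0)
    (h : ∑ j, polyToLaurent k (c j) * HahnSeries.ofPowerSeries ℤ k g ^ p ^ (j : ℕ) = 0) :
    ∃ A : Polynomial (MvPolynomial Unit k), A ≠ 0 ∧ evalAtSeries (σ := Unit) g A = 0 ∧
      A.natDegree ≤ p ^ N - 1 := by
  have hp2 := hp.out.two_le
  by_cases hg : g = 0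
  -- No factor `g` can be cancelled when `g = 0`; here `1 ≤ N` gives `1 ≤ p ^ N - 1`.
  · refine ⟨Polynomial.X, Polynomial.X_ne_zero, ?_, ?_⟩
    · rw [evalAtSeries, Polynomial.eval₂_X, hg]
    · have h1 : p ^ 1 ≤ p ^ N := Nat.pow_le_pow_right hp.out.pos hN
      rw [Polynomial.natDegree_X]
      rw [pow_one] at h1
      omega
  have hinj : ∀ i j : Fin (N + 1), p ^ (i : ℕ) - 1 = p ^ (j : ℕ) - 1 → i = j := by
    intro i j hij
    have hi : 0 < p ^ (i : ℕ) := Nat.pow_pos hp.out.pos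
    have hj : 0 < p ^ (j : ℕ) := Nat.pow_pos hp.out.pos
    exact Fin.ext (Nat.pow_right_injective hp2 (by simp only; omega))
  -- The given relation divided by `y`.
  refine ⟨∑ j : Fin (N + 1), Polynomial.monomial (p ^ (j : ℕ) - 1) (c j), ?_, ?_, ?_⟩
  · obtain ⟨i, hi⟩ := Function.ne_iff.1 hc
    intro h0
    apply hi
    have h1 := congrArg (fun A => Polynomial.coeff A (p ^ (i : ℕ) - 1)) h0
    simp only [Polynomial.finsetSum_coeff, Polynomial.coeff_monomial, Polynomial.coeff_zero] at h1
    rwa [Finset.sum_eq_single_of_mem i (Finset.mem_univ _)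
      (fun j _ hj => if_neg fun e => hj (hinj _ _ e)), if_pos rfl] at h1
  · rw [evalAtSeries, Polynomial.eval₂_finsetSum]
    simp only [Polynomial.eval₂_monomial]
    refine (mul_eq_zero.1 ?_ : _ ∨ g = 0).resolve_right hg
    apply HahnSeries.ofPowerSeries_injective (Γ := ℤ)
    rw [map_zero, ← h, Finset.sum_mul, map_sum]
    refine Finset.sum_congr rfl fun j _ => ?_
    rw [mul_assoc, pow_sub_one_mul (Nat.pow_pos hp.out.pos).ne', map_mul, map_pow]
    rfl
  · refine Polynomial.natDegree_sum_le_of_forall_le _ _ fun j _ => ?_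
    refine (Polynomial.natDegree_monomial_le _).trans (Nat.sub_le_sub_right ?_ 1)
    exact Nat.pow_le_pow_right hp.out.pos (Nat.lt_succ_iff.1 j.2)

/-! ### Boxes and simplices of exponents -/

/-- The exponents whose weights are bounded. -/
def boundedExponents {n : ℕ} {ι : Type*} (w : ι → Fin n → ℕ) (H : ι → ℕ) : Set (LexInt n) :=
  {g | (∀ i, 0 ≤ g i) ∧ ∀ l, ∑ i, (w l i : ℤ) * g i ≤ H l}

section BoundedExponents

variable {n : ℕ} {ι : Type*} {w : ι → Fin n → ℕ} {H : ι → ℕ}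

theorem natExponent_mem_boundedExponents {e : Fin n →₀ ℕ} :
    natExponent n e ∈ boundedExponents w H ↔ ∀ l, ∑ i, w l i * e i ≤ H l := by
  simp only [boundedExponents, Set.mem_ofPred_eq, natExponent_apply]
  refine ⟨fun h l => by exact_mod_cast h.2 l, fun h => ⟨fun i => Int.natCast_nonneg _, fun l => ?_⟩⟩
  exact_mod_cast h l

theorem exists_natExponent_eq {g : LexInt n} (hg : ∀ i, 0 ≤ g i) : ∃ e, natExponent n e = g := by
  refine ⟨Finsupp.equivFunOnFinite.symm fun i => (g i).toNat, ?_⟩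
  funext i
  rw [natExponent_apply]
  exact Int.toNat_of_nonneg (hg i)

open Pointwise in
theorem nsmul_boundedExponents_subset (m : ℕ) :
    m • boundedExponents w H ⊆ boundedExponents w fun l => m * H l := by
  induction m with
  | zero =>
    rw [zero_nsmul]
    rintro g rfl
    refine ⟨fun i => le_rfl, fun l => le_of_eq ?_⟩
    exact (Finset.sum_eq_zero fun i _ => mul_zero _).trans (by simp)
  | succ m ih =>
    rw [succ_nsmul]
    rintro _ ⟨a, ha, b, hb, rfl⟩
    obtain ⟨ha1, ha2⟩ := ih ha
    refine ⟨fun i => add_nonneg (ha1 i) (hb.1 i), fun l => ?_⟩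
    have h1 := add_le_add (ha2 l) (hb.2 l)
    rw [← Finset.sum_add_distrib] at h1
    refine le_trans (le_of_eq (Finset.sum_congr rfl fun i _ => ?_)) (h1.trans (le_of_eq ?_))
    · exact mul_add _ _ _
    · push_cast
      ring

/-- From `p g_i + ρ_i ≥ 0` and `ρ_i < p` follows `g_i > -1`. The weights of `ρ` are nonnegative, so
dropping it keeps the upper bounds. -/
theorem mem_boundedExponents_of_nsmul_add {p : ℕ} [hp : Fact p.Prime] {g ρ : LexInt n}
    (hρ : ∀ i, 0 ≤ ρ i ∧ ρ i < p)
    (h : p • g + ρ ∈ boundedExponents w fun l => p * H l) : g ∈ boundedExponents w H := by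
  have hp0 : (0 : ℤ) < p := by exact_mod_cast hp.out.pos
  have hco : ∀ i, (p • g + ρ) i = p * g i + ρ i := fun i => by
    rw [← nsmul_eq_mul]; rfl
  obtain ⟨h1, h2⟩ := h
  refine ⟨fun i => ?_, fun l => ?_⟩
  · have h3 := h1 i
    rw [hco] at h3
    have h4 := (hρ i).2
    by_contra h5
    nlinarith
  · have h3 := h2 l
    simp only [hco] at h3
    have h4 : (p : ℤ) * ∑ i, (w l i : ℤ) * g i ≤ p * H l := by
      refine le_trans ?_ (h3.trans (le_of_eq (by push_cast; rfl)))
      rw [Finset.mul_sum]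
      refine Finset.sum_le_sum fun i _ => ?_
      have := mul_nonneg (Int.natCast_nonneg (w l i)) (hρ i).1
      linarith
    exact le_of_mul_le_mul_left h4 hp0

theorem mem_boundedExponents_of_nsmul_add' {p : ℕ} [hp : Fact p.Prime] {g ρ : LexInt n}
    (hρ : ∀ i, 0 ≤ ρ i ∧ ρ i < p) (h : p • g + ρ ∈ boundedExponents w H) :
    g ∈ boundedExponents w H := by
  refine mem_boundedExponents_of_nsmul_add hρ ⟨h.1, fun l => (h.2 l).trans ?_⟩
  exact_mod_cast Nat.le_mul_of_pos_left _ hp.out.pos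

theorem exists_residue (p : ℕ) [hp : Fact p.Prime] (g : LexInt n) :
    ∃ ρ ∈ {ρ : LexInt n | ∀ i, 0 ≤ ρ i ∧ ρ i < p}, ∃ g' : LexInt n, g = p • g' + ρ := by
  have hp0 : (0 : ℤ) < p := by exact_mod_cast hp.out.pos
  refine ⟨toLex fun i => g i % p, fun i => ⟨Int.emod_nonneg _ hp0.ne', Int.emod_lt_of_pos _ hp0⟩,
    toLex fun i => g i / p, ?_⟩
  funext i
  change g i = p • (g i / p) + g i % p
  rw [nsmul_eq_mul, Int.mul_ediv_add_emod]

theorem exists_min_coordinate_zero [NeZero n] (e : Fin n →₀ ℕ) :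
    ∃ (e' : Fin n →₀ ℕ) (m : ℕ), (∃ i, e' i = 0) ∧ (∀ i, e' i ≤ e i) ∧
      natExponent n e = natExponent n e' + diagExponent n m := by
  obtain ⟨i, -, hi⟩ := Finset.exists_min_image Finset.univ e ⟨0, Finset.mem_univ _⟩
  refine ⟨Finsupp.equivFunOnFinite.symm fun j => e j - e i, e i, ⟨i, by simp⟩,
    fun j => by simp, ?_⟩
  funext j
  change (e j : ℤ) = ((e j - e i : ℕ) : ℤ) + (e i : ℤ)
  have := hi j (Finset.mem_univ _)
  omega

end BoundedExponents

/-! ### Finitely many generators stable under sections -/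

section Generators

open Polynomial

variable {n : ℕ} [NeZero n] {p : ℕ} [hp : Fact p.Prime] {ι : Type*}
  {w : ι → Fin n → ℕ} {H : ι → ℕ}

/-- The diagonals of `t^e f^j / D`. -/
noncomputable def diagonalGenerator (F D : HahnSeries (LexInt n) (ZMod p)) {d : ℕ}
    {Ω₀ : Finset (Fin n →₀ ℕ)} (x : Fin d × Ω₀) : HahnSeries ℤ (ZMod p) :=
  hahnDiagonal n (HahnSeries.single (natExponent n x.2) 1 * (F ^ (x.1 : ℕ) / D))

/-- The diagonals of the `P(f) / D` lie in the span over `𝔽_p[t]` of the diagonals of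
`t^e f^j / D`. -/
theorem hahnDiagonal_eval_div_mem_span (F D : HahnSeries (LexInt n) (ZMod p)) {d : ℕ}
    {Ω₀ : Finset (Fin n →₀ ℕ)}
    (hΩ₀ : ∀ e, e ∈ Ω₀ ↔ (∃ i, e i = 0) ∧ ∀ l, ∑ i, w l i * e i ≤ H l)
    (hfin : (boundedExponents w H).Finite)
    {P : (HahnSeries (LexInt n) (ZMod p))[X]} (hP : CoeffsIn (boundedExponents w H) P)
    (hd : P.natDegree < d) :
    letI := (polyToLaurent (ZMod p)).toAlgebra
    hahnDiagonal n (P.eval F / D) ∈ Submodule.span (MvPolynomial Unit (ZMod p))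
      (Set.range (diagonalGenerator F D (d := d) (Ω₀ := Ω₀))) := by
  let := (polyToLaurent (ZMod p)).toAlgebra
  have hsum : ∀ j, P.coeff j =
      ∑ g ∈ hfin.toFinset, HahnSeries.single g ((P.coeff j).coeff g) := by
    intro j
    ext g
    rw [HahnSeries.coeff_sum]
    by_cases hg : g ∈ hfin.toFinset
    · rw [Finset.sum_eq_single_of_mem g hg fun b _ hb => HahnSeries.coeff_single_of_ne hb.symm,
        HahnSeries.coeff_single_same]
    · rw [Finset.sum_eq_zero fun b hb => HahnSeries.coeff_single_of_ne fun (e : g = b) =>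
        hg (e.symm ▸ hb)]
      exact hP.coeff_eq_zero j fun h => hg (hfin.mem_toFinset.2 h)
  rw [eval_eq_sum_range' hd, Finset.sum_div, map_sum]
  refine Submodule.sum_mem _ fun j hj => ?_
  rw [mul_div_assoc, hsum, Finset.sum_mul, map_sum]
  refine Submodule.sum_mem _ fun g hg => ?_
  rw [hfin.mem_toFinset] at hg
  obtain ⟨e, rfl⟩ := exists_natExponent_eq hg.1
  obtain ⟨e', m, he', hle, he⟩ := exists_min_coordinate_zero e
  have hmem : e' ∈ Ω₀ := (hΩ₀ e').2 ⟨he', fun l =>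
    (Finset.sum_le_sum fun i _ => Nat.mul_le_mul_left _ (hle i)).trans
      (natExponent_mem_boundedExponents.1 hg l)⟩
  have h1 : ∀ a, hahnDiagonal n (HahnSeries.single (natExponent n e) a * (F ^ j / D)) =
      (MvPolynomial.C a * MvPolynomial.X () ^ m : MvPolynomial Unit (ZMod p)) •
        diagonalGenerator F D ((⟨j, Finset.mem_range.1 hj⟩, ⟨e', hmem⟩) : Fin d × Ω₀) := by
    intro a
    rw [Algebra.smul_def, RingHom.algebraMap_toAlgebra, polyToLaurent_C_mul_X_pow, he,
      hahnDiagonal_single_add_mul]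
    rfl
  rw [h1]
  exact Submodule.smul_mem _ _ (Submodule.subset_span ⟨_, rfl⟩)

/-- Each section of a generator is the diagonal of some `Q(F) / A'(F)` within the same bounds, hence
lies in the span of the generators; its `p`-th power lies in the span of theirs. -/
theorem diagonalGenerator_mem_span_pow {F : HahnSeries (LexInt n) (ZMod p)} {d : ℕ}
    {Ω₀ : Finset (Fin n →₀ ℕ)}
    (hΩ₀ : ∀ e, e ∈ Ω₀ ↔ (∃ i, e i = 0) ∧ ∀ l, ∑ i, w l i * e i ≤ H l)
    (hfin : (boundedExponents w H).Finite)
    {A : (HahnSeries (LexInt n) (ZMod p))[X]} (hA : CoeffsIn (boundedExponents w H) A)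
    (hAF : A.eval F = 0) (hAF' : (derivative A).eval F ≠ 0) (hd : A.natDegree ≤ d)
    (x : Fin d × Ω₀) :
    letI := (polyToLaurent (ZMod p)).toAlgebra
    diagonalGenerator F ((derivative A).eval F) x ∈ Submodule.span (MvPolynomial Unit (ZMod p))
      (Set.range fun x : Fin d × Ω₀ => diagonalGenerator F ((derivative A).eval F) x ^ p) := by
  let := (polyToLaurent (ZMod p)).toAlgebra
  set D := (derivative A).eval F with hD
  set P : (HahnSeries (LexInt n) (ZMod p))[X] :=
    monomial (x.1 : ℕ) (HahnSeries.single (natExponent n x.2) 1) with hP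
  have hPS : CoeffsIn (boundedExponents w H) P := by
    refine coeffsIn_of_coeff_eq_zero fun j g hg => ?_
    rw [hP, coeff_monomial]
    split_ifs
    · refine HahnSeries.coeff_single_of_ne ?_
      rintro rfl
      exact hg (natExponent_mem_boundedExponents.2 ((hΩ₀ _).1 x.2.2).2)
    · rfl
  have hPd : P.natDegree < d := (natDegree_monomial_le _).trans_lt x.1.2
  have hgen : diagonalGenerator F D x = hahnDiagonal n (P.eval F / D) := by
    rw [hP, eval_monomial, mul_div_assoc]
    rfl
  rw [← sum_single_mul_cartier_pow (diagonalGenerator F D x)]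
  refine Submodule.sum_mem _ fun r hr => ?_
  have h1 : HahnSeries.single (r : ℤ) (1 : ZMod p) * cartier p (r : ℤ) (diagonalGenerator F D x) ^ p
      = (MvPolynomial.C 1 * MvPolynomial.X () ^ r : MvPolynomial Unit (ZMod p)) •
        cartier p (r : ℤ) (diagonalGenerator F D x) ^ p := by
    rw [Algebra.smul_def, RingHom.algebraMap_toAlgebra, polyToLaurent_C_mul_X_pow]
  rw [h1]
  refine Submodule.smul_mem _ _ ?_
  have h2 := pow_mem_span_range_pow (R := MvPolynomial Unit (ZMod p)) (p := p) (m := 0)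
    (diagonalGenerator F D (d := d) (Ω₀ := Ω₀))
    (y := cartier p (r : ℤ) (diagonalGenerator F D x))
  simp only [pow_zero, pow_one, zero_add] at h2
  apply h2
  rw [hgen, cartier_hahnDiagonal, cartier_div _ _ _ hAF', hD,
    cartier_eval_mul_derivative_pow _ _ _ _ hAF]
  refine hahnDiagonal_eval_div_mem_span F _ hΩ₀ hfin (hA.polyCartier_mul_pow hPS ?_ _)
    (natDegree_polyCartier_mul_pow_lt hd hPd _)
  intro g hg
  refine mem_boundedExponents_of_nsmul_add (p := p) (fun i => ?_)
    (nsmul_boundedExponents_subset p hg)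
  rw [diagExponent_apply]
  exact ⟨Int.natCast_nonneg r, by exact_mod_cast Finset.mem_range.1 hr⟩

theorem hahnDiagonal_root_mem_span {F : HahnSeries (LexInt n) (ZMod p)} {d : ℕ}
    {Ω₀ : Finset (Fin n →₀ ℕ)}
    (hΩ₀ : ∀ e, e ∈ Ω₀ ↔ (∃ i, e i = 0) ∧ ∀ l, ∑ i, w l i * e i ≤ H l)
    (hfin : (boundedExponents w H).Finite)
    {A : (HahnSeries (LexInt n) (ZMod p))[X]} (hA : CoeffsIn (boundedExponents w H) A)
    (hAF : A.eval F = 0) (hAF' : (derivative A).eval F ≠ 0) (hd : A.natDegree ≤ d) (hd0 : 0 < d) :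
    letI := (polyToLaurent (ZMod p)).toAlgebra
    hahnDiagonal n F ∈ Submodule.span (MvPolynomial Unit (ZMod p))
      (Set.range (diagonalGenerator F ((derivative A).eval F) (d := d) (Ω₀ := Ω₀))) := by
  -- Since `A(F) = 0`, `P(F) = F A'(F)`. Subtracting `d • A` multiplies the coefficient of index `q`
  -- by `q - d`, which removes the term of degree `d`.
  set P : (HahnSeries (LexInt n) (ZMod p))[X] := X * derivative A - d • A with hP
  have hco : ∀ q, P.coeff q = (q : ℤ) • A.coeff q - d • A.coeff q := by
    intro q
    rw [hP, coeff_sub, coeff_smul]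
    cases q with
    | zero => simp
    | succ q =>
      rw [coeff_X_mul, coeff_derivative]
      congr 1
      rw [zsmul_eq_mul, mul_comm]
      push_cast
      rfl
  have hPS : CoeffsIn (boundedExponents w H) P := by
    refine coeffsIn_of_coeff_eq_zero fun j g hg => ?_
    rw [hco, HahnSeries.coeff_sub, HahnSeries.coeff_smul, HahnSeries.coeff_smul,
      hA.coeff_eq_zero j hg]
    simp
  have hPd : P.natDegree < d := by
    refine Nat.lt_of_le_of_lt (m := d - 1) (natDegree_le_iff_coeff_eq_zero.2 fun q hq => ?_)
      (by omega)
    rw [hco]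
    rcases (show d ≤ q by omega).eq_or_lt with rfl | h
    · rw [natCast_zsmul, sub_self]
    · rw [coeff_eq_zero_of_natDegree_lt (by omega), smul_zero, smul_zero, sub_zero]
  have h1 : F = P.eval F / (derivative A).eval F := by
    rw [hP, eval_sub, eval_mul, eval_X, eval_smul, hAF, smul_zero, sub_zero,
      mul_div_cancel_right₀ _ hAF']
  have h2 := hahnDiagonal_eval_div_mem_span F ((derivative A).eval F) hΩ₀ hfin hPS hPd
  rwa [← h1] at h2

/-- Algebraicity of the diagonal of an algebraic power series over `𝔽_p`. -/
theorem exists_algebraic_relation_diagonal (f : MvPowerSeries (Fin n) (ZMod p))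
    (B : (MvPolynomial (Fin n) (ZMod p))[X]) (hB0 : B ≠ 0) (hBf : evalAtSeries f B = 0) {d : ℕ}
    (hBd : B.natDegree ≤ d)
    (hBw : ∀ j, ∀ e ∈ (B.coeff j).support, ∀ l, ∑ i, w l i * e i ≤ H l)
    (Ω₀ : Finset (Fin n →₀ ℕ))
    (hΩ₀ : ∀ e, e ∈ Ω₀ ↔ (∃ i, e i = 0) ∧ ∀ l, ∑ i, w l i * e i ≤ H l)
    (hfin : (boundedExponents w H).Finite) :
    ∃ A : (MvPolynomial Unit (ZMod p))[X], A ≠ 0 ∧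
      evalAtSeries (σ := Unit) (diagonal f) A = 0 ∧ A.natDegree ≤ p ^ (d * Ω₀.card) - 1 := by
  set φ : MvPolynomial (Fin n) (ZMod p) →+* HahnSeries (LexInt n) (ZMod p) :=
    toHahn.comp MvPolynomial.coeToMvPowerSeries.ringHom with hφ
  have hφinj : Function.Injective φ :=
    toHahn_injective.comp (MvPolynomial.coe_injective (Fin n) (ZMod p))
  set F := toHahn f with hF
  have hG0 : B.map φ ≠ 0 := (Polynomial.map_ne_zero_iff hφinj).2 hB0
  have hGF : (B.map φ).eval F = 0 := by
    rw [eval_map, hφ, hF, ← Polynomial.hom_eval₂, ← evalAtSeries, hBf, map_zero]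
  have hGS : CoeffsIn (boundedExponents w H) (B.map φ) := by
    refine coeffsIn_of_coeff_eq_zero fun j g hg => ?_
    rw [coeff_map]
    change (toHahn ((B.coeff j : MvPolynomial (Fin n) (ZMod p)) :
      MvPowerSeries (Fin n) (ZMod p))).coeff g = 0
    by_cases hr : g ∈ Set.range (natExponent n)
    · obtain ⟨e, rfl⟩ := hr
      rw [coeff_toHahn, MvPolynomial.coeff_coe]
      by_contra h
      exact hg (natExponent_mem_boundedExponents.2 (hBw j e (MvPolynomial.mem_support_iff.2 h)))
    · exact coeff_toHahn_of_notMem_range _ hr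
  obtain ⟨A, hAS, hAF, hAF', hAd⟩ := exists_simple_root (exists_residue p)
    (fun ρ hρ g => mem_boundedExponents_of_nsmul_add' hρ) F _ hG0 hGS hGF
  have hAd' : A.natDegree ≤ d := hAd.trans (natDegree_map_le.trans hBd)
  -- Both factors of `d * Ω₀.card` must be positive, to cover a zero diagonal.
  have hd0 : 0 < d := by
    by_contra h
    apply hAF'
    rw [eq_C_of_natDegree_eq_zero (by omega : A.natDegree = 0), derivative_C, eval_zero]
  have hΩ0 : 0 < Ω₀.card := by
    obtain ⟨j, hj⟩ : ∃ j, B.coeff j ≠ 0 := by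
      by_contra! h
      exact hB0 (Polynomial.ext h)
    obtain ⟨e, he⟩ := MvPolynomial.ne_zero_iff.1 hj
    obtain ⟨e', m, he', hle, -⟩ := exists_min_coordinate_zero e
    exact Finset.card_pos.2 ⟨e', (hΩ₀ e').2 ⟨he', fun l =>
      (Finset.sum_le_sum fun i _ => Nat.mul_le_mul_left _ (hle i)).trans
        (hBw j e (MvPolynomial.mem_support_iff.2 he) l)⟩⟩
  let := (polyToLaurent (ZMod p)).toAlgebra
  obtain ⟨c, hc, hrel⟩ := exists_frobenius_relation (R := MvPolynomial Unit (ZMod p)) (p := p) _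
    (diagonalGenerator_mem_span_pow (Ω₀ := Ω₀) hΩ₀ hfin hAS hAF hAF' hAd')
    (hahnDiagonal_root_mem_span hΩ₀ hfin hAS hAF hAF' hAd' hd0)
  have hcard : Fintype.card (Fin d × Ω₀) = d * Ω₀.card := by
    rw [Fintype.card_prod, Fintype.card_fin, Fintype.card_coe]
  rw [← hcard]
  refine exists_algebraic_relation_of_frobenius_relation (diagonal f) ?_ c hc ?_
  · rw [hcard]
    exact Nat.mul_pos hd0 hΩ0
  · rw [← hahnDiagonal_toHahn, ← hF]
    simp only [Algebra.smul_def] at hrel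
    exact hrel

end Generators

/-! ### Weights of divisors -/

section WeightHom

open Polynomial

variable {n : ℕ} {k : Type*} [Field k]

/-- The substitution `t_i ↦ t_i s^(w_i)` on coefficients. -/
noncomputable def weightCoeffHom (w : Fin n → ℕ) :
    MvPolynomial (Fin n) k →+* (MvPolynomial (Fin n) k)[X][X] :=
  MvPolynomial.eval₂Hom (S₁ := (MvPolynomial (Fin n) k)[X][X])
    (RingHom.comp C (RingHom.comp C MvPolynomial.C)) fun i => C (C (MvPolynomial.X i)) * X ^ w i

/-- The substitution `t_i ↦ t_i s^(w_i)`. -/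
noncomputable def weightHom (w : Fin n → ℕ) :
    (MvPolynomial (Fin n) k)[X] →+* (MvPolynomial (Fin n) k)[X][X] :=
  eval₂RingHom (S := (MvPolynomial (Fin n) k)[X][X]) (weightCoeffHom w) (C X)

theorem prod_mul_pow_weight {T : Type*} [CommRing T] (w : Fin n → ℕ) (a : Fin n → T) (x : T)
    (e : Fin n →₀ ℕ) : (e.prod fun i m => (a i * x ^ w i) ^ m) =
      (e.prod fun i m => a i ^ m) * x ^ ∑ i, w i * e i := by
  rw [Finsupp.prod_fintype _ _ fun i => pow_zero _, Finsupp.prod_fintype _ _ fun i => pow_zero _]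
  simp only [mul_pow, Finset.prod_mul_distrib, ← pow_mul, Finset.prod_pow_eq_pow_sum]

theorem weightHom_monomial_monomial (w : Fin n → ℕ) (j : ℕ) (e : Fin n →₀ ℕ) (r : k) :
    weightHom w (monomial j (MvPolynomial.monomial e r)) =
      monomial (∑ i, w i * e i) (monomial j (MvPolynomial.monomial e r)) := by
  have h1 : weightCoeffHom w (MvPolynomial.monomial e r) =
      C (C (MvPolynomial.monomial e r)) * X ^ ∑ i, w i * e i := by
    have h2 := prod_mul_pow_weight w
      (fun i => (C (C (MvPolynomial.X i)) : (MvPolynomial (Fin n) k)[X][X])) X e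
    rw [weightCoeffHom, MvPolynomial.coe_eval₂Hom, MvPolynomial.eval₂_monomial]
    refine (congrArg _ h2).trans ?_
    rw [MvPolynomial.monomial_eq, ← mul_assoc]
    congr 1
    simp only [map_mul, map_finsuppProd, map_pow, RingHom.comp_apply]
  rw [weightHom, coe_eval₂RingHom, eval₂_monomial, h1, ← C_mul_X_pow_eq_monomial,
    ← C_mul_X_pow_eq_monomial, map_mul, map_pow]
  ring

theorem coeff_weightHom (w : Fin n → ℕ) (A : (MvPolynomial (Fin n) k)[X]) (m j : ℕ)
    (e : Fin n →₀ ℕ) : (((weightHom w A).coeff m).coeff j).coeff e =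
      if ∑ i, w i * e i = m then (A.coeff j).coeff e else 0 := by
  classical
  induction A using Polynomial.induction_on' with
  | add A A' h h' =>
    simp only [map_add, coeff_add, MvPolynomial.coeff_add, h, h']
    split_ifs <;> simp
  | monomial j' a =>
    induction a using MvPolynomial.induction_on' with
    | add a a' h h' =>
      simp only [map_add, coeff_add, MvPolynomial.coeff_add, h, h']
      split_ifs <;> simp
    | monomial e' r =>
      rw [weightHom_monomial_monomial, coeff_monomial]
      by_cases he : e' = e
      · subst he
        split_ifs <;> simp
      · have h1 : ∀ j, ((monomial j' (MvPolynomial.monomial e' r)).coeff j).coeff e = 0 := by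
          intro j
          rw [coeff_monomial]
          split_ifs
          · rw [MvPolynomial.coeff_monomial, if_neg he]
          · rfl
        split_ifs <;> simp [h1]

/-- The weight becomes the degree in the extra variable `s`, and degrees over a domain do not
increase on passing to divisors of a nonzero polynomial. -/
theorem natDegree_weightHom_le_iff (w : Fin n → ℕ) (A : (MvPolynomial (Fin n) k)[X]) (H : ℕ) :
    (weightHom w A).natDegree ≤ H ↔
      ∀ j, ∀ e ∈ (A.coeff j).support, ∑ i, w i * e i ≤ H := by
  rw [natDegree_le_iff_coeff_eq_zero]
  constructor
  · intro h j e he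
    by_contra! h1
    have h2 := coeff_weightHom w A (∑ i, w i * e i) j e
    rw [if_pos rfl, h _ h1, coeff_zero, MvPolynomial.coeff_zero] at h2
    exact MvPolynomial.mem_support_iff.1 he h2.symm
  · intro h m hm
    ext j e
    rw [coeff_weightHom, coeff_zero, MvPolynomial.coeff_zero]
    split_ifs with h1
    · by_contra h2
      have := h j e (MvPolynomial.mem_support_iff.2 h2)
      omega
    · rfl

theorem weightHom_injective (w : Fin n → ℕ) :
    Function.Injective (weightHom (k := k) w) := by
  rw [injective_iff_map_eq_zero]
  intro A hA
  ext j e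
  have h := coeff_weightHom w A (∑ i, w i * e i) j e
  rw [if_pos rfl, hA] at h
  simpa using h.symm

/-- A bound on the weights of a polynomial passes to its divisors. -/
theorem weight_le_of_dvd (w : Fin n → ℕ) {q A : (MvPolynomial (Fin n) k)[X]} (hA : A ≠ 0)
    (hq : q ∣ A) {H : ℕ} (h : ∀ j, ∀ e ∈ (A.coeff j).support, ∑ i, w i * e i ≤ H) :
    ∀ j, ∀ e ∈ (q.coeff j).support, ∑ i, w i * e i ≤ H := by
  rw [← natDegree_weightHom_le_iff] at h ⊢
  refine (natDegree_le_of_dvd (map_dvd (weightHom w) hq) ?_).trans h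
  rwa [Ne, map_eq_zero_iff _ (weightHom_injective w)]

end WeightHom

/-! ### Gauss's lemma: a generator of the annihilating polynomials -/

section PrimeGenerator

open Polynomial

variable {R S : Type*} [CommRing R] [UniqueFactorizationMonoid R] [CommRing S]
  [IsDomain S]

theorem exists_prime_dvd_of_eval₂_eq_zero (φ : R →+* S) (s : S) (A : R[X]) (hA : A ≠ 0)
    (hAs : A.eval₂ φ s = 0) : ∃ q, Prime q ∧ q ∣ A ∧ q.eval₂ φ s = 0 := by
  induction A using UniqueFactorizationMonoid.induction_on_prime with
  | h₁ => exact absurd rfl hA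
  | h₂ x hx =>
    have h := hx.map (eval₂RingHom φ s)
    rw [coe_eval₂RingHom, hAs] at h
    exact absurd h not_isUnit_zero
  | h₃ a q ha hq ih =>
    rw [eval₂_mul] at hAs
    rcases mul_eq_zero.1 hAs with h | h
    · exact ⟨q, hq, dvd_mul_right _ _, h⟩
    · obtain ⟨r, hr, hra, hrs⟩ := ih ha h
      exact ⟨r, hr, hra.mul_left _, hrs⟩

/-- The polynomials vanishing at an algebraic element are the multiples of one of them. -/
theorem exists_dvd_of_eval₂_eq_zero [IsDomain R] (φ : R →+* S) (hφ : Function.Injective φ) (s : S) (A : R[X])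
    (hA : A ≠ 0) (hAs : A.eval₂ φ s = 0) :
    ∃ q : R[X], q ≠ 0 ∧ q.eval₂ φ s = 0 ∧ ∀ B : R[X], B.eval₂ φ s = 0 → q ∣ B := by
  classical
  have hex : ∃ m, ∃ A : R[X], A ≠ 0 ∧ A.eval₂ φ s = 0 ∧ A.natDegree = m := ⟨_, A, hA, hAs, rfl⟩
  obtain ⟨A, hA, hAs, hAm⟩ := Nat.find_spec hex
  obtain ⟨q, hq, hqA, hqs⟩ := exists_prime_dvd_of_eval₂_eq_zero φ s A hA hAs
  have hmin : ∀ B : R[X], B.eval₂ φ s = 0 → B.natDegree < q.natDegree → B = 0 := by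
    intro B hB hlt
    by_contra hB0
    refine Nat.find_min hex (m := B.natDegree) ?_ ⟨B, hB0, hB, rfl⟩
    rw [← hAm]
    exact hlt.trans_le (natDegree_le_of_dvd hqA hA)
  have hdeg : q.natDegree ≠ 0 := by
    intro h
    rw [eq_C_of_natDegree_eq_zero h, eval₂_C, map_eq_zero_iff _ hφ] at hqs
    exact hq.ne_zero (by rw [eq_C_of_natDegree_eq_zero h, hqs, C_0])
  -- Pseudo-division by `q`: the remainder vanishes at `s` and has degree below the minimum, so it
  -- is zero.
  have hmul : ∀ m, ∀ B : R[X], B.natDegree = m → B.eval₂ φ s = 0 → ∃ c, c ≠ 0 ∧ q ∣ C c * B := by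
    intro m
    induction m using Nat.strong_induction_on with
    | _ m ih =>
    intro B hBm hB
    by_cases hlt : B.natDegree < q.natDegree
    · rw [hmin B hB hlt]
      exact ⟨1, one_ne_zero, by simp⟩
    · have hle : q.natDegree ≤ B.natDegree := not_lt.1 hlt
      have hlt' := natDegree_cancelLeads_lt_of_natDegree_le_natDegree hle (by omega)
      have heval : (q.cancelLeads B).eval₂ φ s = 0 := by
        rw [cancelLeads, eval₂_sub, eval₂_mul, eval₂_mul _ _ (p := _ * _), hB, hqs]
        simp
      obtain ⟨c, hc, hdvd⟩ := ih _ (hBm ▸ hlt') _ rfl heval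
      refine ⟨c * q.leadingCoeff, mul_ne_zero hc (leadingCoeff_ne_zero.2 hq.ne_zero), ?_⟩
      rw [cancelLeads, Nat.sub_eq_zero_of_le hle, pow_zero, mul_one, mul_sub] at hdvd
      have h1 := dvd_add hdvd (Dvd.intro_left (C c * (C B.leadingCoeff *
        X ^ (B.natDegree - q.natDegree))) rfl)
      convert h1 using 1
      rw [C_mul]
      ring
  refine ⟨q, hq.ne_zero, hqs, fun B hB => ?_⟩
  obtain ⟨c, hc, hdvd⟩ := hmul _ B rfl hB
  -- A prime of positive degree does not divide a nonzero constant, so it divides `B`.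
  refine (hq.dvd_or_dvd hdvd).resolve_left fun h => hdeg ?_
  have := natDegree_le_of_dvd h (C_ne_zero.2 hc)
  rw [natDegree_C] at this
  omega

end PrimeGenerator

/-! ### Reduction of a relation modulo `p` -/

section Reduction

open Polynomial

variable {n : ℕ}

/-- Finitely many rational numbers, not all zero, are proportional to integers that are not all
divisible by a given prime. -/
theorem exists_primitive_multiple {ι : Type*} (s : Finset ι) (v : ι → ℚ) {i₀ : ι} (hi₀ : i₀ ∈ s)
    (hv : v i₀ ≠ 0) (p : ℕ) [hp : Fact p.Prime] :
    ∃ (c : ℚ) (z : ι → ℤ), (∀ i ∈ s, c * v i = z i) ∧ ∃ i ∈ s, ((z i : ℤ) : ZMod p) ≠ 0 := by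
  classical
  obtain ⟨b, hb⟩ := IsLocalization.exist_integer_multiples (nonZeroDivisors ℤ) s v
  choose! y hy using hb
  have hb0 : ((b : ℤ) : ℚ) ≠ 0 := by exact_mod_cast nonZeroDivisors.coe_ne_zero b
  have hy' : ∀ i ∈ s, (y i : ℚ) = ((b : ℤ) : ℚ) * v i := by
    intro i hi
    have h := hy i hi
    rw [zsmul_eq_mul] at h
    simpa using h
  -- After clearing denominators, dividing by the gcd leaves integers of gcd `1`, so `p` cannot
  -- divide them all.
  obtain ⟨z, hz, hz1⟩ := Finset.extract_gcd y ⟨i₀, hi₀⟩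
  have hg : s.gcd y ≠ 0 := by
    intro h
    have h1 := Finset.gcd_eq_zero_iff.1 h i₀ hi₀
    have h2 := hy' i₀ hi₀
    rw [h1, Int.cast_zero] at h2
    exact mul_ne_zero hb0 hv h2.symm
  refine ⟨((b : ℤ) : ℚ) / (s.gcd y : ℤ), z, fun i hi => ?_, ?_⟩
  · have hgq : ((s.gcd y : ℤ) : ℚ) ≠ 0 := by exact_mod_cast hg
    rw [div_mul_eq_mul_div, ← hy' i hi, div_eq_iff hgq, hz i hi]
    push_cast
    ring
  · by_contra! h
    have h1 : (p : ℤ) ∣ s.gcd z :=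
      Finset.dvd_gcd fun i hi => (ZMod.intCast_zmod_eq_zero_iff_dvd _ p).1 (h i hi)
    rw [hz1] at h1
    exact hp.out.one_lt.ne' (by exact_mod_cast Int.eq_one_of_dvd_one (Int.natCast_nonneg p) h1)

theorem eval₂_map_coe {R S : Type*} [CommRing R] [CommRing S] (g : R →+* S)
    (f : MvPowerSeries (Fin n) R) (A : (MvPolynomial (Fin n) R)[X]) :
    (A.map (MvPolynomial.map g)).eval₂ MvPolynomial.coeToMvPowerSeries.ringHom
      (MvPowerSeries.map g f) =
    MvPowerSeries.map g (A.eval₂ MvPolynomial.coeToMvPowerSeries.ringHom f) := by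
  rw [eval₂_map, hom_eval₂]
  congr 1

/-- An algebraic relation over `ℚ` for a power series with integer coefficients yields one
modulo `p`. -/
theorem exists_reduction_mod (f : MvPowerSeries (Fin n) ℤ) (q : (MvPolynomial (Fin n) ℚ)[X])
    (hq : q ≠ 0) (hqf : evalAtSeries (MvPowerSeries.map (Int.castRingHom ℚ) f) q = 0)
    (p : ℕ) [hp : Fact p.Prime] :
    ∃ B : (MvPolynomial (Fin n) (ZMod p))[X], B ≠ 0 ∧
      evalAtSeries (MvPowerSeries.map (Int.castRingHom (ZMod p)) f) B = 0 ∧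
      B.natDegree ≤ q.natDegree ∧ ∀ j, (B.coeff j).support ⊆ (q.coeff j).support := by
  classical
  set s : Finset (Σ _ : ℕ, Fin n →₀ ℕ) := q.support.sigma fun j => (q.coeff j).support with hs
  have hmem : ∀ j e, (⟨j, e⟩ : Σ _ : ℕ, Fin n →₀ ℕ) ∈ s ↔ (q.coeff j).coeff e ≠ 0 := by
    intro j e
    rw [hs, Finset.mem_sigma, MvPolynomial.mem_support_iff, mem_support_iff]
    refine ⟨fun h => h.2, fun h => ⟨fun h0 => h ?_, h⟩⟩
    simp only [h0, MvPolynomial.coeff_zero]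
  obtain ⟨j₀, hj₀⟩ : ∃ j, q.coeff j ≠ 0 := by
    by_contra! h
    exact hq (Polynomial.ext h)
  obtain ⟨e₀, he₀⟩ := MvPolynomial.ne_zero_iff.1 hj₀
  obtain ⟨c, z, hz, ⟨j₁, e₁⟩, hi₁, hz₁⟩ := exists_primitive_multiple s
    (fun x => (q.coeff x.1).coeff x.2) ((hmem j₀ e₀).2 he₀) he₀ p
  set A : (MvPolynomial (Fin n) ℤ)[X] :=
    ∑ x ∈ s, monomial x.1 (MvPolynomial.monomial x.2 (z x)) with hA
  have hAc : ∀ j e, (A.coeff j).coeff e =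
      if (⟨j, e⟩ : Σ _ : ℕ, Fin n →₀ ℕ) ∈ s then z ⟨j, e⟩ else 0 := by
    intro j e
    have h1 : ∀ x : Σ _ : ℕ, Fin n →₀ ℕ,
        ((monomial x.1 (MvPolynomial.monomial x.2 (z x))).coeff j).coeff e =
          if x = ⟨j, e⟩ then z x else 0 := by
      rintro ⟨j', e'⟩
      rw [coeff_monomial]
      by_cases hj : j' = j
      · subst hj
        rw [if_pos rfl, MvPolynomial.coeff_monomial]
        simp
      · rw [if_neg hj, MvPolynomial.coeff_zero, if_neg]
        simp [hj]
    rw [hA, finsetSum_coeff, MvPolynomial.coeff_sum, Finset.sum_congr rfl fun x _ => h1 x,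
      Finset.sum_ite_eq']
  have hAq : A.map (MvPolynomial.map (Int.castRingHom ℚ)) = C (MvPolynomial.C c) * q := by
    ext j e
    rw [coeff_map, MvPolynomial.coeff_map, hAc, coeff_C_mul, MvPolynomial.coeff_C_mul]
    split_ifs with h
    · rw [hz _ h]
      rfl
    · rw [hmem, not_not] at h
      rw [h, mul_zero, map_zero]
  have hAf : A.eval₂ MvPolynomial.coeToMvPowerSeries.ringHom f = 0 := by
    have hinj : Function.Injective (MvPowerSeries.map (σ := Fin n) (Int.castRingHom ℚ)) := by
      intro a b h
      ext e
      have h1 := congrArg (MvPowerSeries.coeff e) h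
      simpa using h1
    apply hinj
    rw [← eval₂_map_coe, hAq, eval₂_mul, ← evalAtSeries, ← evalAtSeries, hqf, mul_zero, map_zero]
  refine ⟨A.map (MvPolynomial.map (Int.castRingHom (ZMod p))), ?_, ?_, ?_, ?_⟩
  · intro h
    apply hz₁
    have h1 := congrArg (fun B => (coeff B j₁).coeff e₁) h
    simp only [coeff_map, MvPolynomial.coeff_map, hAc, if_pos hi₁, coeff_zero,
      MvPolynomial.coeff_zero] at h1
    simpa using h1
  · rw [evalAtSeries, eval₂_map_coe, hAf, map_zero]
  · refine natDegree_le_iff_coeff_eq_zero.2 fun j hj => ?_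
    ext e
    rw [coeff_map, MvPolynomial.coeff_map, hAc, if_neg, map_zero, MvPolynomial.coeff_zero]
    rw [hmem, not_not, coeff_eq_zero_of_natDegree_lt hj, MvPolynomial.coeff_zero]
  · intro j e he
    rw [MvPolynomial.mem_support_iff, coeff_map, MvPolynomial.coeff_map, hAc] at he
    rw [MvPolynomial.mem_support_iff, ← hmem]
    by_contra h
    rw [if_neg h, map_zero] at he
    exact he rfl

end Reduction

/-! ### Simultaneous minimality of degree and heights -/

section Heights

variable {n : ℕ} {k : Type*} [Field k]

theorem degT_le_iff (i : Fin n) (A : Polynomial (MvPolynomial (Fin n) k)) (H : ℕ) :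
    degT i A ≤ H ↔
      ∀ j, ∀ e ∈ (A.coeff j).support, ∑ i', (Pi.single i 1 : Fin n → ℕ) i' * e i' ≤ H := by
  have h1 : ∀ e : Fin n →₀ ℕ, ∑ i', (Pi.single i 1 : Fin n → ℕ) i' * e i' = e i := by
    intro e
    simp [Pi.single_apply]
  simp only [h1]
  rw [degT, Finset.sup_le_iff]
  refine ⟨fun h j e he => ?_, fun h j _ => MvPolynomial.degreeOf_le_iff.2 fun e he => h j e he⟩
  refine MvPolynomial.degreeOf_le_iff.1 (h j ?_) e he
  rw [Polynomial.mem_support_iff]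
  intro h0
  rw [h0] at he
  simp at he

theorem totalDegT_le_iff (A : Polynomial (MvPolynomial (Fin n) k)) (H : ℕ) :
    totalDegT A ≤ H ↔
      ∀ j, ∀ e ∈ (A.coeff j).support, ∑ i', (1 : Fin n → ℕ) i' * e i' ≤ H := by
  have h1 : ∀ e : Fin n →₀ ℕ, ∑ i', (1 : Fin n → ℕ) i' * e i' = e.sum fun _ m => m := by
    intro e
    rw [Finsupp.sum_fintype _ _ fun _ => rfl]
    simp
  simp only [h1]
  rw [totalDegT, Finset.sup_le_iff]
  refine ⟨fun h j e he => ?_, fun h j _ => Finset.sup_le fun e he => h j e he⟩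
  refine (MvPolynomial.le_totalDegree he).trans (h j ?_)
  rw [Polynomial.mem_support_iff]
  intro h0
  rw [h0] at he
  simp at he

/-- One relation realizes the degree, the total height and the partial height. -/
theorem exists_simultaneous_minimal_relation {f : MvPowerSeries (Fin n) k} {d h : ℕ}
    {hs : Fin n → ℕ} (hd : HasAlgDegree f d) (hh : HasTotalHeight f h)
    (hhs : HasPartialHeight f hs) :
    ∃ q : Polynomial (MvPolynomial (Fin n) k), q ≠ 0 ∧ evalAtSeries f q = 0 ∧ q.natDegree ≤ d ∧
      (∀ j, ∀ e ∈ (q.coeff j).support, ∑ i', (1 : Fin n → ℕ) i' * e i' ≤ h) ∧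
      ∀ i j, ∀ e ∈ (q.coeff j).support,
        ∑ i', (Pi.single i 1 : Fin n → ℕ) i' * e i' ≤ hs i := by
  obtain ⟨A, hA0, hAf, hAd⟩ := hd.1
  have : IsDomain (MvPowerSeries (Fin n) k) := NoZeroDivisors.to_isDomain _
  -- The generator divides every polynomial that realizes one of the minima, so it inherits each
  -- bound.
  obtain ⟨q, hq0, hqf, hdvd⟩ := exists_dvd_of_eval₂_eq_zero
    (MvPolynomial.coeToMvPowerSeries.ringHom (σ := Fin n) (R := k))
    (MvPolynomial.coe_injective (Fin n) k) f A hA0 hAf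
  refine ⟨q, hq0, hqf, ?_, ?_, fun i => ?_⟩
  · rw [← hAd]
    exact Polynomial.natDegree_le_of_dvd (hdvd A hAf) hA0
  · obtain ⟨B, hB0, hBf, hBh⟩ := hh.1
    exact weight_le_of_dvd _ hB0 (hdvd B hBf) ((totalDegT_le_iff B h).1 hBh.le)
  · obtain ⟨B, hB0, hBf, hBh⟩ := (hhs i).1
    exact weight_le_of_dvd _ hB0 (hdvd B hBf) ((degT_le_iff i B (hs i)).1 hBh.le)

end Heights

/-! ### Counting exponents with a zero coordinate -/

section Counting

open Finset

variable {n : ℕ}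

theorem finite_boundedExponents {ι : Type*} {w : ι → Fin n → ℕ} {H : ι → ℕ}
    (T : Finset (Fin n →₀ ℕ)) (hT : ∀ e, (∀ l, ∑ i, w l i * e i ≤ H l) → e ∈ T) :
    (boundedExponents w H).Finite := by
  refine (T.finite_toSet.image (natExponent n)).subset fun g hg => ?_
  obtain ⟨e, rfl⟩ := exists_natExponent_eq hg.1
  exact ⟨e, hT e (natExponent_mem_boundedExponents.1 hg), rfl⟩

/-- The exponents in a box. -/
noncomputable def boxExponents (hs : Fin n → ℕ) : Finset (Fin n →₀ ℕ) :=
  (Fintype.piFinset fun i => range (hs i + 1)).map Finsupp.equivFunOnFinite.symm.toEmbedding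

theorem mem_boxExponents {hs : Fin n → ℕ} {e : Fin n →₀ ℕ} :
    e ∈ boxExponents hs ↔ ∀ i, e i ≤ hs i := by
  rw [boxExponents, Finset.mem_map_equiv, Fintype.mem_piFinset]
  simp

/-- The exponents excluded are those with all coordinates in `[1, h_i]`. -/
theorem card_boxExponents_filter_le (hs : Fin n → ℕ) :
    #{e ∈ boxExponents hs | ∃ i, e i = 0} ≤ ∏ i, (hs i + 1) - ∏ i, hs i := by
  classical
  set T := (Fintype.piFinset fun i => Icc 1 (hs i)).map
    (Finsupp.equivFunOnFinite (α := Fin n) (M := ℕ)).symm.toEmbedding with hT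
  have hmem : ∀ e, e ∈ T ↔ ∀ i, 1 ≤ e i ∧ e i ≤ hs i := by
    intro e
    rw [hT, Finset.mem_map_equiv, Fintype.mem_piFinset]
    simp
  have hsub : T ⊆ boxExponents hs := fun e he =>
    mem_boxExponents.2 fun i => ((hmem e).1 he i).2
  have hcard : #(boxExponents hs \ T) = ∏ i, (hs i + 1) - ∏ i, hs i := by
    rw [card_sdiff_of_subset hsub, boxExponents, hT, card_map, card_map, Fintype.card_piFinset,
      Fintype.card_piFinset]
    simp
  rw [← hcard]
  refine card_le_card fun e he => ?_
  rw [Finset.mem_filter] at he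
  obtain ⟨he, i, hi⟩ := he
  refine mem_sdiff.2 ⟨he, fun h => ?_⟩
  have := ((hmem e).1 h i).1
  omega

/-- The exponents in a simplex. -/
noncomputable def simplexExponents (n H : ℕ) : Finset (Fin n →₀ ℕ) :=
  (range (H + 1)).biUnion fun m => univ.finsuppAntidiag m

theorem mem_simplexExponents {H : ℕ} {e : Fin n →₀ ℕ} :
    e ∈ simplexExponents n H ↔ ∑ i, e i ≤ H := by
  simp [simplexExponents, mem_finsuppAntidiag]

/-- Slicing by total degree gives a hockey-stick sum. -/
theorem card_simplexExponents (hn : 1 ≤ n) (H : ℕ) :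
    #(simplexExponents n H) = (n + H).choose n := by
  obtain ⟨n, rfl⟩ : ∃ n', n = n' + 1 := ⟨n - 1, by omega⟩
  rw [simplexExponents, card_biUnion]
  · simp only [card_finsuppAntidiag_nat_eq_choose, card_univ, Fintype.card_fin]
    rw [show n + 1 + H = H + n + 1 by ring, ← Nat.sum_range_add_choose]
    refine Finset.sum_congr rfl fun m _ => ?_
    rw [show n + 1 + m - 1 = m + n by omega, Nat.choose_symm_add]
  · intro a _ b _ hab
    rw [Function.onFun, disjoint_left]
    intro e ha hb
    rw [mem_finsuppAntidiag] at ha hb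
    exact hab (ha.1.symm.trans hb.1)

theorem card_simplexExponents_filter_le (hn : 1 ≤ n) (H : ℕ) :
    #{e ∈ simplexExponents n H | ∃ i, e i = 0} ≤ (n + H).choose n - H.choose n := by
  have h1 : #{e ∈ simplexExponents n H | ∃ i, e i = 0} +
      #{e ∈ simplexExponents n H | ¬ ∃ i, e i = 0} = (n + H).choose n := by
    rw [card_filter_add_card_filter_not, card_simplexExponents hn]
  -- Translation by `(1, …, 1)` embeds the simplex of size `H - n` into the positive exponents; for
  -- `H < n` the binomial is `0`.
  have h2 : H.choose n ≤ #{e ∈ simplexExponents n H | ¬ ∃ i, e i = 0} := by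
    by_cases hH : n ≤ H
    swap
    · rw [Nat.choose_eq_zero_of_lt (by omega)]
      exact Nat.zero_le _
    have h3 := card_simplexExponents hn (H - n)
    rw [Nat.add_sub_cancel' hH] at h3
    rw [← h3]
    set o : Fin n →₀ ℕ := Finsupp.equivFunOnFinite.symm fun _ => 1 with ho
    have ho' : ∀ i, o i = 1 := fun i => rfl
    refine card_le_card_of_injOn (fun e => e + o) (fun e he => ?_)
      fun a _ b _ hab => add_right_cancel hab
    have he' := mem_simplexExponents.1 he
    refine Finset.mem_coe.2 (Finset.mem_filter.2 ⟨mem_simplexExponents.2 ?_, ?_⟩)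
    · simp only [Finsupp.add_apply, ho', sum_add_distrib, sum_const, card_univ, Fintype.card_fin,
        smul_eq_mul, mul_one]
      omega
    · rintro ⟨i, hi⟩
      simp only [Finsupp.add_apply, ho'] at hi
      omega
  omega

end Counting

/-! ### The bound for the diagonal -/

theorem theorem5 {n : ℕ} (hn : 1 ≤ n) (f : MvPowerSeries (Fin n) ℤ)
    (d h : ℕ) (hs : Fin n → ℕ)
    (hd : HasAlgDegree (MvPowerSeries.map (Int.castRingHom ℚ) f) d)
    (hh : HasTotalHeight (MvPowerSeries.map (Int.castRingHom ℚ) f) h)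
    (hhs : HasPartialHeight (MvPowerSeries.map (Int.castRingHom ℚ) f) hs)
    (p : ℕ) [Fact p.Prime] :
    ∃ D : ℕ, HasAlgDegree (PowerSeries.map (Int.castRingHom (ZMod p)) (diagonal f)) D ∧
      D ≤ p ^ boundN d h hs - 1 := by
  classical
  have : NeZero n := ⟨by omega⟩
  have hp1 : 1 ≤ p := (Fact.out : p.Prime).one_lt.le
  obtain ⟨q, hq0, hqf, hqd, hqh, hqs⟩ := exists_simultaneous_minimal_relation hd hh hhs
  obtain ⟨B, hB0, hBf, hBq, hBsupp⟩ := exists_reduction_mod f q hq0 hqf p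
  have hdiag : PowerSeries.map (Int.castRingHom (ZMod p)) (diagonal f) =
      diagonal (MvPowerSeries.map (Int.castRingHom (ZMod p)) f) := by
    ext i
    simp [diagonal]
  have hbox : ∀ e : Fin n →₀ ℕ,
      (∀ i, ∑ i', (Pi.single i 1 : Fin n → ℕ) i' * e i' ≤ hs i) ↔ e ∈ boxExponents hs := by
    intro e
    rw [mem_boxExponents]
    simp [Pi.single_apply]
  have hsimplex : ∀ e : Fin n →₀ ℕ,
      (Unit → ∑ i', (1 : Fin n → ℕ) i' * e i' ≤ h) ↔ e ∈ simplexExponents n h := by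
    intro e
    rw [mem_simplexExponents]
    simp
  obtain ⟨A₁, hA₁, hA₁f, hA₁d⟩ := exists_algebraic_relation_diagonal
    (w := fun i => (Pi.single i 1 : Fin n → ℕ)) (H := hs) _ B hB0 hBf (hBq.trans hqd)
    (fun j e he i => hqs i j e (hBsupp j he))
    {e ∈ boxExponents hs | ∃ i, e i = 0}
    (fun e => by rw [Finset.mem_filter, hbox, and_comm])
    (finite_boundedExponents _ fun e => (hbox e).1)
  obtain ⟨A₂, hA₂, hA₂f, hA₂d⟩ := exists_algebraic_relation_diagonal
    (w := fun _ : Unit => (1 : Fin n → ℕ)) (H := fun _ => h) _ B hB0 hBf (hBq.trans hqd)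
    (fun j e he _ => hqh j e (hBsupp j he))
    {e ∈ simplexExponents n h | ∃ i, e i = 0}
    (fun e => by rw [Finset.mem_filter, hsimplex, and_comm])
    (finite_boundedExponents _ fun e => (hsimplex e).1)
  set S : Set ℕ := {m | ∃ A : Polynomial (MvPolynomial Unit (ZMod p)), A ≠ 0 ∧
      evalAtSeries (σ := Unit) (PowerSeries.map (Int.castRingHom (ZMod p)) (diagonal f)) A = 0 ∧
      A.natDegree = m}
  have hS₁ : A₁.natDegree ∈ S := ⟨A₁, hA₁, by rw [hdiag, hA₁f], rfl⟩
  have hS₂ : A₂.natDegree ∈ S := ⟨A₂, hA₂, by rw [hdiag, hA₂f], rfl⟩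
  refine ⟨sInf S, ⟨Nat.sInf_mem ⟨_, hS₁⟩, fun m hm => Nat.sInf_le hm⟩, ?_⟩
  -- Only the powers `f^j` with `j < d` serve as generators, so the factor `d` is obtained where `d
  -- + 1` is allowed.
  have key : ∀ a b : ℕ, a ≤ b → p ^ (d * a) - 1 ≤ p ^ ((d + 1) * b) - 1 := fun a b hab =>
    Nat.sub_le_sub_right (Nat.pow_le_pow_right hp1 (Nat.mul_le_mul (Nat.le_succ d) hab)) 1
  rw [boundN]
  rcases min_choice (∏ i, (hs i + 1) - ∏ i, hs i) ((n + h).choose n - h.choose n) with hm | hm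
  · rw [hm]
    exact (Nat.sInf_le hS₁).trans
      (hA₁d.trans (key _ _ (card_boxExponents_filter_le hs)))
  · rw [hm]
    exact (Nat.sInf_le hS₂).trans
      (hA₂d.trans (key _ _ (card_simplexExponents_filter_le hn h)))
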